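/- There is a constant $C$ such that the following holds. Let $D$ be a finite (nonempty) distributive lattice and let $n$ be the number of its join-irreducible elements (the zero of $D$ is not counted as join-irreducible). Then there exists a finite (nonempty) lattice $S$ such that (i) $S$ is semimodular: for all $a, b \in S$, if $a$ covers $a \wedge b$, then $a \vee b$ covers $b$; (ii) $S$ is planar: the elements of $S$ can be represented by distinct points of the plane so that, if for every covering pair $a \prec b$ the points of $a$ and $b$ are joined by a straight line segment, then $b$ is placed higher than $a$, no segment passes through the point of an element other than its two ends, and any two different segments meet only in common end points; (iii) the lattice $\operatorname{Con} S$ of all congruence relations of $S$, ordered by inclusion, is isomorphic to $D$; (iv) if $n \ge 1$, then $|S| \le C n^3$ (that is, $S$ has size $O(n^3)$). -/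

import Mathlib

/-- Distinct lattice congruences have distinct underlying equivalence relations. -/
theorem LatticeCon.toSetoid_injective {α : Type*} [Lattice α] :
    Function.Injective (LatticeCon.toSetoid : LatticeCon α → Setoid α) := by
  rintro ⟨r, _, _⟩ ⟨s, _, _⟩ h
  cases h
  rfl

/-- The congruences of a lattice, ordered by inclusion: `c ≤ d` means that `c.r x y` implies
`d.r x y` for all `x` and `y`. With this order they form the congruence lattice. -/
instance LatticeCon.instPartialOrder {α : Type*} [Lattice α] : PartialOrder (LatticeCon α) :=
  PartialOrder.lift LatticeCon.toSetoid LatticeCon.toSetoid_injective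

theorem LatticeCon.le_iff {α : Type*} [Lattice α] {c d : LatticeCon α} :
    c ≤ d ↔ ∀ x y : α, c.r x y → d.r x y :=
  Iff.rfl

/-- `f` places the elements of the ordered set `P` in the plane so that drawing a straight line
segment from `a` to `b` for every covering pair `a ⋖ b` yields a planar (Hasse) diagram of `P`. -/
structure IsPlanarDiagram {P : Type*} [PartialOrder P] (f : P → ℝ × ℝ) : Prop where
  /-- Distinct elements are drawn as distinct points. -/
  injective : Function.Injective f
  /-- If `b` covers `a`, then `b` is drawn higher than `a`. -/
  height_lt : ∀ a b : P, a ⋖ b → (f a).2 < (f b).2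
  /-- An edge passes through no element other than its two ends. -/
  vertex_mem : ∀ a b x : P, a ⋖ b → f x ∈ segment ℝ (f a) (f b) → x = a ∨ x = b
  /-- Two different edges meet only in a common end. -/
  edge_inter : ∀ a b c d : P, a ⋖ b → c ⋖ d → (a, b) ≠ (c, d) →
    ∀ p : ℝ × ℝ, p ∈ segment ℝ (f a) (f b) → p ∈ segment ℝ (f c) (f d) →
      ∃ x : P, (x = a ∨ x = b) ∧ (x = c ∨ x = d) ∧ p = f x

/-- An ordered set is planar if it has a planar diagram. -/
def IsPlanarOrder (P : Type*) [PartialOrder P] : Prop :=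
  ∃ f : P → ℝ × ℝ, IsPlanarDiagram f

/-! Let `P` be the ordered set of the `n` join-irreducible elements of `D`; by Birkhoff's theorem
`D` is the lattice of lower sets of `P`. It suffices to find a small planar semimodular lattice
whose edges can be coloured by `P` so that a congruence is determined by the colours it collapses
and precisely the lower sets of colours occur.

Take a chain with `m ≤ n ^ 2` edges, coloured in blocks: the block headed by `q` shows each `p ≤ q`
(`exists_strips`). Of the square of this chain keep the diagonal and the points whose smaller
coordinate is a head (`Grid`). An element of this lattice has at most two covers, and two covers
span a covering square, so it is semimodular. Left of the diagonal the second coordinate moves by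
whole blocks, right of it the first one does. Hence a congruence collapsing the head edge of `q` on
the right boundary collapses its whole block (`collapsesRight_of_block`): `q` forces every `p ≤ q`.

To tie together the edges of one colour, an eye is put into the cell where the strip `s` on the left
meets the block of its own colour; the cell becomes an `M₃` (`collapsesLeft_iff_eye`,
`collapsesRight_iff_eye`). So the collapsed colours form a lower set, and they determine the
congruence, since every element is a join of coloured join-irreducibles. Conversely, for a lower set
`U`, lying above the same join-irreducibles with colour outside `U` respects meets, and by
semimodularity joins need checking only at pairs of covers (`rel_sup_of_covBy`,
`exists_cell_colors`).

The lattice embeds into the plane with its componentwise order (`position_le`), hence is planar. It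
consists of a diagonal, two families of `n` lines with at most `m + 1` points each, and `m` eyes,
which is `O(n ^ 3)` elements. -/

/-! ### Planarity of lattices of order dimension two -/

/-- A lattice that embeds into the plane with its componentwise order is planar: rotate the
picture by 45 degrees. -/
theorem isPlanarOrder_of_orderEmbedding {S : Type*} [Lattice S] (f : S ↪o ℝ × ℝ) :
    IsPlanarOrder S := by
  let g : S → ℝ × ℝ := fun x => ((f x).2 - (f x).1, (f x).1 + (f x).2)
  have hle : ∀ x y, x ≤ y ↔ (f x).1 ≤ (f y).1 ∧ (f x).2 ≤ (f y).2 := fun x y => by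
    rw [← f.le_iff_le, Prod.le_def]
  have hg : Function.Injective g := by
    intro x y h
    simp only [g, Prod.mk.injEq] at h
    apply f.injective
    ext <;> linarith [h.1, h.2]
  -- Undoing the rotation, each point of an edge lies between its two ends in the componentwise
  -- order.
  have key : ∀ x y, x ≤ y → ∀ p ∈ segment ℝ (g x) (g y),
      ((f x).1 ≤ (p.2 - p.1) / 2 ∧ (f x).2 ≤ (p.2 + p.1) / 2) ∧
      ((p.2 - p.1) / 2 ≤ (f y).1 ∧ (p.2 + p.1) / 2 ≤ (f y).2) := by
    rintro x y hxy p ⟨s, t, hs, ht, hst, rfl⟩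
    obtain ⟨h1, h2⟩ := (hle x y).1 hxy
    obtain rfl : s = 1 - t := by linarith
    simp only [g, Prod.fst_add, Prod.snd_add, Prod.smul_fst, Prod.smul_snd, smul_eq_mul]
    refine ⟨⟨?_, ?_⟩, ?_, ?_⟩ <;> nlinarith
  -- Two edges up from `a` that meet again are parallel, so their upper ends are comparable, which
  -- is impossible for distinct covers of `a`.
  have bot_case : ∀ {a b d : S} {p : ℝ × ℝ}, a ⋖ b → a ⋖ d → b ≠ d →
      p ∈ segment ℝ (g a) (g b) → p ∈ segment ℝ (g a) (g d) → p = g a := by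
    rintro a b d p hab had hbd ⟨s, t, hs, ht, hst, rfl⟩ ⟨s', t', hs', ht', hst', hp⟩
    obtain rfl : s = 1 - t := by linarith
    obtain rfl : s' = 1 - t' := by linarith
    simp only [g, Prod.ext_iff, Prod.fst_add, Prod.snd_add, Prod.smul_fst, Prod.smul_snd,
      smul_eq_mul] at hp ⊢
    obtain ⟨h1, h2⟩ := (hle _ _).1 hab.le
    obtain ⟨h3, h4⟩ := (hle _ _).1 had.le
    have e1 : t' * ((f d).1 - (f a).1) = t * ((f b).1 - (f a).1) := by linarith
    have e2 : t' * ((f d).2 - (f a).2) = t * ((f b).2 - (f a).2) := by linarith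
    rcases eq_or_lt_of_le ht with rfl | ht
    · constructor <;> ring
    rcases eq_or_lt_of_le ht' with rfl | ht'
    · constructor <;> linarith
    exfalso
    rcases le_total t t' with h | h
    · have : d ≤ b := (hle _ _).2 ⟨by nlinarith, by nlinarith⟩
      rcases hab.eq_or_eq had.le this with h | h
      · exact had.ne h.symm
      · exact hbd h.symm
    · have : b ≤ d := (hle _ _).2 ⟨by nlinarith, by nlinarith⟩
      rcases had.eq_or_eq hab.le this with h | h
      · exact hab.ne h.symm
      · exact hbd h
  have top_case : ∀ {a b c : S} {p : ℝ × ℝ}, a ⋖ b → c ⋖ b → a ≠ c →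
      p ∈ segment ℝ (g a) (g b) → p ∈ segment ℝ (g c) (g b) → p = g b := by
    rintro a b c p hab hcb hac ⟨s, t, hs, ht, hst, rfl⟩ ⟨s', t', hs', ht', hst', hp⟩
    obtain rfl : t = 1 - s := by linarith
    obtain rfl : t' = 1 - s' := by linarith
    simp only [g, Prod.ext_iff, Prod.fst_add, Prod.snd_add, Prod.smul_fst, Prod.smul_snd,
      smul_eq_mul] at hp ⊢
    obtain ⟨h1, h2⟩ := (hle _ _).1 hab.le
    obtain ⟨h3, h4⟩ := (hle _ _).1 hcb.le
    have e1 : s' * ((f b).1 - (f c).1) = s * ((f b).1 - (f a).1) := by linarith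
    have e2 : s' * ((f b).2 - (f c).2) = s * ((f b).2 - (f a).2) := by linarith
    rcases eq_or_lt_of_le hs with rfl | hs
    · constructor <;> ring
    rcases eq_or_lt_of_le hs' with rfl | hs'
    · constructor <;> linarith
    exfalso
    rcases le_total s s' with h | h
    · have : a ≤ c := (hle _ _).2 ⟨by nlinarith, by nlinarith⟩
      rcases hab.eq_or_eq this hcb.le with h | h
      · exact hac h.symm
      · exact hcb.ne h
    · have : c ≤ a := (hle _ _).2 ⟨by nlinarith, by nlinarith⟩
      rcases hcb.eq_or_eq this hab.le with h | h
      · exact hac h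
      · exact hab.ne h
  refine ⟨g, hg, ?_, ?_, ?_⟩
  · intro a b hab
    obtain ⟨h1, h2⟩ := (hle _ _).1 hab.le
    have h3 : ¬ ((f b).1 ≤ (f a).1 ∧ (f b).2 ≤ (f a).2) := fun h => hab.lt.not_ge ((hle _ _).2 h)
    simp only [g]
    by_contra h
    exact h3 ⟨by linarith, by linarith⟩
  · intro a b x hab hx
    obtain ⟨h1, h2⟩ := key a b hab.le _ hx
    refine hab.eq_or_eq ((hle _ _).2 ?_) ((hle _ _).2 ?_)
    · simp only [g] at h1; exact ⟨by linarith, by linarith⟩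
    · simp only [g] at h2; exact ⟨by linarith, by linarith⟩
  · intro a b c d hab hcd hne p hp hp'
    obtain ⟨h1, h2⟩ := key a b hab.le _ hp
    obtain ⟨h3, h4⟩ := key c d hcd.le _ hp'
    -- A common point of two edges lies above both lower ends and below both upper ends. As `S` is a
    -- lattice, `a ⊔ c` lies in both covering intervals, so it is an end of each edge: four cases
    -- remain.
    have hac : a ≤ b ⊓ d := le_inf hab.le ((hle _ _).2 ⟨h1.1.trans h4.1, h1.2.trans h4.2⟩)
    have hcb : c ≤ b ⊓ d := le_inf ((hle _ _).2 ⟨h3.1.trans h2.1, h3.2.trans h2.2⟩) hcd.le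
    have h5 := sup_le hac hcb
    have eq_of : ∀ x : S, ((f x).1 ≤ (p.2 - p.1) / 2 ∧ (f x).2 ≤ (p.2 + p.1) / 2) →
        ((p.2 - p.1) / 2 ≤ (f x).1 ∧ (p.2 + p.1) / 2 ≤ (f x).2) → p = g x := by
      intro x hx hx'
      ext
      · simp only [g]; linarith [hx.1, hx.2, hx'.1, hx'.2]
      · simp only [g]; linarith [hx.1, hx.2, hx'.1, hx'.2]
    rcases hab.eq_or_eq le_sup_left (h5.trans inf_le_left) with e | e <;>
    rcases hcd.eq_or_eq le_sup_right (h5.trans inf_le_right) with e' | e'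
    · have hac : a = c := e.symm.trans e'
      subst hac
      exact ⟨a, .inl rfl, .inl rfl, bot_case hab hcd (fun h => hne (by rw [h])) hp hp'⟩
    · have had : a = d := e.symm.trans e'
      subst had
      exact ⟨a, .inl rfl, .inr rfl, eq_of a h1 h4⟩
    · have hbc : b = c := e.symm.trans e'
      subst hbc
      exact ⟨b, .inr rfl, .inl rfl, eq_of b h3 h2⟩
    · have hbd : b = d := e.symm.trans e'
      subst hbd
      exact ⟨b, .inr rfl, .inr rfl, top_case hab hcd (fun h => hne (by rw [h])) hp hp'⟩

/-! ### Semimodularity and congruences of finite lattices -/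

/-- In a finite lattice Birkhoff's condition implies semimodularity. -/
theorem isUpperModularLattice_of_isWeakUpperModularLattice {S : Type*} [Lattice S] [Finite S]
    [IsWeakUpperModularLattice S] : IsUpperModularLattice S where
  covBy_sup_of_inf_covBy := by
    intro a b
    generalize hz : a ⊓ b = z
    induction z using WellFoundedGT.induction generalizing a with
    | ind z ih =>
      intro hza
      have hzb : z ≤ b := hz ▸ inf_le_right
      rcases hzb.eq_or_lt with rfl | hlt
      · rwa [sup_eq_left.2 (hz ▸ inf_le_left)]
      -- Climb from `z` to `b` one cover at a time; the pair `a ⊔ c`, `b` meets in `c` and inherits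
      -- the hypothesis.
      obtain ⟨c, hzc, hcb⟩ := exists_covBy_le_of_lt hlt
      have hac : a ⊓ c = z := le_antisymm (hz ▸ inf_le_inf_left a hcb) (le_inf hza.le hzc.le)
      have hcov : c ⋖ a ⊔ c := by
        rw [sup_comm]
        apply IsWeakUpperModularLattice.covBy_sup_of_inf_covBy_covBy <;>
          rw [inf_comm, hac] <;> assumption
      have hinf : (a ⊔ c) ⊓ b = c := by
        rcases hcov.eq_or_eq (le_inf le_sup_right hcb) inf_le_left with h | h
        · exact h
        · exfalso
          have hab : a ≤ b := le_sup_left.trans (h.symm.le.trans inf_le_right)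
          exact hza.ne (hz.symm.trans (inf_eq_left.2 hab))
      have := ih c hzc.lt hinf hcov
      rwa [sup_assoc, sup_eq_right.2 hcb] at this

/-- In a finite semimodular lattice, an equivalence that is compatible with meets is compatible
with joins as soon as it is so for any two covers of the same element. -/
theorem rel_sup_of_covBy {S : Type*} [Lattice S] [Finite S] [IsWeakUpperModularLattice S]
    (r : Setoid S) (hinf : ∀ {x y} z, r x y → r (x ⊓ z) (y ⊓ z))
    (hcov : ∀ {z x y}, z ⋖ x → z ⋖ y → x ≠ y → r z x → r y (x ⊔ y)) {x y : S} (z : S)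
    (hxy : r x y) : r (x ⊔ z) (y ⊔ z) := by
  -- A related edge is pushed up along a maximal chain from `x` to `z`; semimodularity keeps it an
  -- edge and `hcov` keeps it related.
  have step : ∀ x y z : S, x ⋖ y → x ≤ z → r x y → r z (y ⊔ z) := by
    intro x
    induction x using WellFoundedGT.induction with
    | ind x ih =>
      intro y z hxy hxz hr
      rcases hxz.eq_or_lt with rfl | hlt
      · rwa [sup_eq_left.2 hxy.le]
      obtain ⟨c, hxc, hcz⟩ := exists_covBy_le_of_lt hlt
      rcases eq_or_ne y c with rfl | hne
      · rw [sup_eq_right.2 hcz]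
      have hyc : y ⊓ c = x := by
        rcases hxy.eq_or_eq (le_inf hxy.le hxc.le) inf_le_left with h | h
        · exact h
        · rcases hxc.eq_or_eq hxy.le (inf_eq_left.1 h) with h' | h'
          · exact absurd h'.symm hxy.ne
          · exact absurd h' hne
      have hcov' : c ⋖ y ⊔ c := by
        rw [sup_comm]
        apply IsWeakUpperModularLattice.covBy_sup_of_inf_covBy_covBy <;>
          rw [inf_comm, hyc] <;> assumption
      have := ih c hxc.lt (y ⊔ c) z hcov' hcz (hcov hxy hxc hne hr)
      rwa [sup_assoc, sup_eq_right.2 hcz] at this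
  have le_case : ∀ x y : S, x ≤ y → r x y → r (x ⊔ z) (y ⊔ z) := by
    intro x
    induction x using WellFoundedGT.induction with
    | ind x ih =>
      intro y hxy hr
      rcases hxy.eq_or_lt with rfl | hlt
      · exact r.refl _
      obtain ⟨c, hxc, hcy⟩ := exists_covBy_le_of_lt hlt
      have hrc : r x c := by
        have := hinf c hr
        rwa [inf_eq_left.2 hxc.le, inf_eq_right.2 hcy] at this
      have h1 := step x c (x ⊔ z) hxc le_sup_left hrc
      rw [← sup_assoc, sup_eq_left.2 hxc.le] at h1
      exact r.trans h1 (ih c hxc.lt y hcy (r.trans (r.symm hrc) hr))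
  -- Compatibility with meets reduces arbitrary related pairs to comparable ones.
  have h1 : r (x ⊓ y) x := by
    have := hinf x hxy
    rw [inf_idem, inf_comm] at this
    exact r.symm this
  have h2 : r (x ⊓ y) y := r.trans h1 hxy
  exact r.trans (r.symm (le_case _ _ inf_le_left h1)) (le_case _ _ inf_le_right h2)

/-- The equivalence of lying above the same members of `Q`. -/
def sameLower {S : Type*} [Lattice S] (Q : Set S) : Setoid S where
  r x y := ∀ q ∈ Q, q ≤ x ↔ q ≤ y
  iseqv := ⟨fun _ _ _ => Iff.rfl, fun h q hq => (h q hq).symm,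
    fun h h' q hq => (h q hq).trans (h' q hq)⟩

theorem sameLower_inf {S : Type*} [Lattice S] {Q : Set S} {x y : S} (z : S)
    (h : sameLower Q x y) : sameLower Q (x ⊓ z) (y ⊓ z) := fun q hq => by
  simp only [le_inf_iff, h q hq]

theorem sameLower_of_le {S : Type*} [Lattice S] {Q : Set S} {x y : S} (hxy : x ≤ y)
    (h : ∀ q ∈ Q, q ≤ y → q ≤ x) : sameLower Q x y :=
  fun q hq => ⟨fun hx => hx.trans hxy, h q hq⟩

namespace LatticeCon

variable {S : Type*} [Lattice S] (c : LatticeCon S) {x y : S}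

theorem inf_left (h : c.r x y) (z : S) : c.r (z ⊓ x) (z ⊓ y) := c.inf (c.refl z) h

theorem sup_left (h : c.r x y) (z : S) : c.r (z ⊔ x) (z ⊔ y) := c.sup (c.refl z) h

theorem r_of_between {u v : S} (h : c.r x y) (hxu : x ≤ u) (huv : u ≤ v) (hvy : v ≤ y) :
    c.r u v := by
  have h1 := c.inf_left (c.sup_left h u) v
  rwa [sup_eq_left.2 hxu, inf_eq_right.2 huv, sup_eq_right.2 (huv.trans hvy),
    inf_eq_left.2 hvy] at h1

/-- If an edge is perspective upward to an edge, then a congruence collapses both or none. -/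
theorem r_of_persp {u v : S} (h : c.r x y) (hu : x ⊔ u = u) (hv : y ⊔ u = v) : c.r u v := by
  have := c.sup h (c.refl u)
  rwa [hu, hv] at this

theorem r_of_persp_down {u v : S} (h : c.r x y) (hu : x ⊓ v = u) (hv : y ⊓ v = v) : c.r u v := by
  have := c.inf h (c.refl v)
  rwa [hu, hv] at this

/-- The congruence whose classes are the sets of elements above the same members of `Q`. -/
def ofSameLower [Finite S] [IsWeakUpperModularLattice S] (Q : Set S)
    (h : ∀ {z x y : S}, z ⋖ x → z ⋖ y → x ≠ y → sameLower Q z x → sameLower Q y (x ⊔ y)) :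
    LatticeCon S where
  toSetoid := sameLower Q
  inf {w x y z} h1 h2 := fun q hq => by simp only [le_inf_iff, h1 q hq, h2 q hq]
  sup {w x y z} h1 h2 := by
    have a := rel_sup_of_covBy (sameLower Q) sameLower_inf h y h1
    have b := rel_sup_of_covBy (sameLower Q) sameLower_inf h x h2
    rw [sup_comm y, sup_comm z] at b
    exact (sameLower Q).trans a b

end LatticeCon

/-! ### Inserting eyes into intervals of a lattice -/

/-- The lattice `L` with one new element `eye e` strictly inside each interval `[o e, i e]`. -/
inductive WithEyes {L E : Type} (o i : E → L) : Type
  | base (x : L) : WithEyes o i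
  | eye (e : E) : WithEyes o i

namespace WithEyes

variable {L E : Type} {o i : E → L}

/-- The greatest old element below an element. -/
def lo : WithEyes o i → L
  | base x => x
  | eye e => o e

/-- The least old element above an element. -/
def hi : WithEyes o i → L
  | base x => x
  | eye e => i e

@[simp] theorem lo_base (x : L) : (base x : WithEyes o i).lo = x := rfl
@[simp] theorem hi_base (x : L) : (base x : WithEyes o i).hi = x := rfl
@[simp] theorem lo_eye (e : E) : (eye e : WithEyes o i).lo = o e := rfl
@[simp] theorem hi_eye (e : E) : (eye e : WithEyes o i).hi = i e := rfl

theorem base_injective : Function.Injective (base : L → WithEyes o i) := fun _ _ h => by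
  injection h

/-- `WithEyes o i` consists of the elements of `L` and the eyes. -/
def equivSum (o i : E → L) : WithEyes o i ≃ L ⊕ E where
  toFun | base x => .inl x | eye e => .inr e
  invFun | .inl x => base x | .inr e => eye e
  left_inv x := by cases x <;> rfl
  right_inv x := by cases x <;> rfl

instance [Finite L] [Finite E] : Finite (WithEyes o i) := Finite.of_equiv _ (equivSum o i).symm

variable [Lattice L] [hlt : Fact (∀ e, o e < i e)]

theorem lo_le_hi (x : WithEyes o i) : x.lo ≤ x.hi := by
  cases x with
  | base x => exact le_rfl
  | eye e => exact (hlt.out e).le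

instance : PartialOrder (WithEyes o i) where
  le x y := x = y ∨ x.hi ≤ y.lo
  le_refl x := .inl rfl
  le_trans x y z := by
    rintro (rfl | h) (rfl | h')
    · exact .inl rfl
    · exact .inr h'
    · exact .inr h
    · exact .inr (h.trans (y.lo_le_hi.trans h'))
  le_antisymm x y := by
    rintro (rfl | h) (h' | h')
    · rfl
    · rfl
    · exact h'.symm
    · have hx := le_antisymm x.lo_le_hi (h.trans (y.lo_le_hi.trans h'))
      have hy := le_antisymm y.lo_le_hi (h'.trans (x.lo_le_hi.trans h))
      cases x with
      | eye e => exact absurd hx (hlt.out e).ne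
      | base x =>
        cases y with
        | eye e => exact absurd hy (hlt.out e).ne
        | base y => exact congrArg base (le_antisymm h h')

theorem le_def {x y : WithEyes o i} : x ≤ y ↔ x = y ∨ x.hi ≤ y.lo := Iff.rfl

theorem base_le {a : L} {x : WithEyes o i} : base a ≤ x ↔ a ≤ x.lo := by
  rw [le_def]
  refine ⟨?_, .inr⟩
  rintro (rfl | h)
  · exact le_rfl
  · exact h

theorem le_base {a : L} {x : WithEyes o i} : x ≤ base a ↔ x.hi ≤ a := by
  rw [le_def]
  refine ⟨?_, .inr⟩
  rintro (rfl | h)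
  · exact le_rfl
  · exact h

theorem base_le_base {a b : L} : (base a : WithEyes o i) ≤ base b ↔ a ≤ b := base_le

theorem base_lt_base {a b : L} : (base a : WithEyes o i) < base b ↔ a < b := by
  simp only [lt_iff_le_not_ge, base_le_base]

theorem eye_le_eye {e e' : E} : (eye e : WithEyes o i) ≤ eye e' ↔ e = e' ∨ i e ≤ o e' := by
  rw [le_def, eye.injEq]; rfl

theorem base_lo_le (x : WithEyes o i) : base x.lo ≤ x := base_le.2 le_rfl

theorem le_base_hi (x : WithEyes o i) : x ≤ base x.hi := le_base.2 le_rfl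

open Classical in
noncomputable instance : Lattice (WithEyes o i) where
  -- Two distinct elements are comparable only through an old element between them, so bounds of
  -- incomparable elements can be computed in `L`.
  sup x y := if x ≤ y then y else if y ≤ x then x else base (x.hi ⊔ y.hi)
  inf x y := if x ≤ y then x else if y ≤ x then y else base (x.lo ⊓ y.lo)
  le_sup_left x y := by
    split_ifs with h h'
    · exact h
    · exact le_rfl
    · exact le_base.2 le_sup_left
  le_sup_right x y := by
    split_ifs with h h'
    · exact le_rfl
    · exact h'
    · exact le_base.2 le_sup_right
  sup_le x y z hx hy := by
    split_ifs with h h'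
    · exact hy
    · exact hx
    · rcases hx with rfl | hx
      · exact absurd hy h'
      rcases hy with rfl | hy
      · exact absurd (.inr hx) h
      exact base_le.2 (sup_le hx hy)
  inf_le_left x y := by
    split_ifs with h h'
    · exact le_rfl
    · exact h'
    · exact base_le.2 inf_le_left
  inf_le_right x y := by
    split_ifs with h h'
    · exact h
    · exact le_rfl
    · exact base_le.2 inf_le_right
  le_inf x y z hx hy := by
    split_ifs with h h'
    · exact hx
    · exact hy
    · rcases hx with rfl | hx
      · exact absurd hy h
      rcases hy with rfl | hy
      · exact absurd (.inr hx) h'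
      exact le_base.2 (le_inf hx hy)

theorem base_sup_base (a b : L) : (base a ⊔ base b : WithEyes o i) = base (a ⊔ b) := by
  apply le_antisymm
  · exact sup_le (base_le_base.2 le_sup_left) (base_le_base.2 le_sup_right)
  · rw [base_le]
    exact sup_le (base_le.1 le_sup_left) (base_le.1 le_sup_right)

theorem base_inf_base (a b : L) : (base a ⊓ base b : WithEyes o i) = base (a ⊓ b) := by
  apply le_antisymm
  · rw [le_base]
    exact le_inf (le_base.1 inf_le_left) (le_base.1 inf_le_right)
  · exact le_inf (base_le_base.2 inf_le_left) (base_le_base.2 inf_le_right)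

theorem eye_covBy_base (e : E) : (eye e : WithEyes o i) ⋖ base (i e) := by
  refine ⟨(le_base_hi _).lt_of_ne (by simp), ?_⟩
  intro y h1 h2
  have h3 : i e ≤ y.lo := (le_def.1 h1.le).resolve_left h1.ne
  exact h2.not_ge (base_le.2 h3)

theorem eq_of_eye_covBy {e : E} {x : WithEyes o i} (h : eye e ⋖ x) : x = base (i e) := by
  have h3 : i e ≤ x.lo := (le_def.1 h.le).resolve_left h.ne
  rcases h.eq_or_eq (eye_covBy_base e).le (base_le.2 h3) with h' | h'
  · simp at h'
  · exact h'.symm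

theorem of_base_covBy {z : L} {x : WithEyes o i} (h : base z ⋖ x) :
    (∃ a, x = base a ∧ z ⋖ a) ∨ ∃ e, x = eye e ∧ o e = z := by
  cases x with
  | base a =>
    refine .inl ⟨a, rfl, base_lt_base.1 h.lt, fun c h1 h2 => ?_⟩
    exact h.2 (base_lt_base.2 h1) (base_lt_base.2 h2)
  | eye e =>
    refine .inr ⟨e, rfl, ?_⟩
    rcases h.eq_or_eq (base_le_base.2 (base_le.1 h.le)) (base_lo_le (eye e)) with h' | h'
    · exact base_injective h'
    · simp at h'

/-- An eye strictly between `a` and `b` would have `[a, b]` as its interval, but the intervals of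
eyes are not covers. -/
theorem base_covBy_base {a b : L} (h : a ⋖ b) (hno : ∀ e, ¬ o e ⋖ i e) :
    (base a : WithEyes o i) ⋖ base b := by
  refine ⟨base_lt_base.2 h.lt, ?_⟩
  intro y h1 h2
  cases y with
  | base c => exact h.2 (base_lt_base.1 h1) (base_lt_base.1 h2)
  | eye e =>
    have h3 := base_le.1 h1.le
    have h4 := le_base.1 h2.le
    simp only [lo_eye, hi_eye] at h3 h4
    apply hno e
    have h5 := hlt.out e
    rcases h.eq_or_eq h3 (h5.le.trans h4) with h6 | h6
    · rcases h.eq_or_eq (h3.trans h5.le) h4 with h7 | h7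
      · exact absurd (h6.trans h7.symm) h5.ne
      · rwa [h6, h7]
    · exact absurd (h6.ge.trans_lt h5) (not_lt_of_ge h4)

theorem base_sup_eye {e : E} {x : L} (h : o e < x) (h' : x ≤ i e) :
    (base x ⊔ eye e : WithEyes o i) = base (i e) := by
  apply le_antisymm
  · exact sup_le (base_le_base.2 h') (le_base_hi _)
  · have h1 : eye e ≤ (base x ⊔ eye e : WithEyes o i) := le_sup_right
    rcases le_def.1 h1 with h2 | h2
    · have h3 : (base x : WithEyes o i) ≤ eye e := h2 ▸ le_sup_left
      exact absurd (base_le.1 h3) h.not_ge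
    · exact base_le.2 h2

theorem base_inf_eye {e : E} {x : L} (h : o e ≤ x) (h' : x < i e) :
    (base x ⊓ eye e : WithEyes o i) = base (o e) := by
  apply le_antisymm
  · have h1 : (base x ⊓ eye e : WithEyes o i) ≤ eye e := inf_le_right
    rcases le_def.1 h1 with h2 | h2
    · have h3 : (eye e : WithEyes o i) ≤ base x := h2.symm.le.trans inf_le_left
      exact absurd (le_base.1 h3) h'.not_ge
    · exact le_base.2 h2
  · exact le_inf (base_le_base.2 h) (base_lo_le (eye e))

/-- An eye has a single cover. Over an old element, two old covers behave as in `L`, an old cover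
and an eye join to the top of the eye's interval, and two eyes are excluded because `o` is
injective. -/
theorem isWeakUpperModularLattice [IsWeakUpperModularLattice L] (ho : Function.Injective o)
    (hcov : ∀ e x, o e ⋖ x → x ⋖ i e) (hno : ∀ e, ¬ o e ⋖ i e) :
    IsWeakUpperModularLattice (WithEyes o i) where
  covBy_sup_of_inf_covBy_covBy {x y} := by
    have hxy : x ⊓ y ⋖ x → x ≠ y := by
      rintro h rfl
      exact h.ne (inf_idem x)
    generalize hz : x ⊓ y = z at hxy ⊢
    intro hx hy
    specialize hxy hx
    cases z with
    | eye e => exact absurd ((eq_of_eye_covBy hx).trans (eq_of_eye_covBy hy).symm) hxy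
    | base z =>
      rcases of_base_covBy hx with ⟨a, rfl, ha⟩ | ⟨e, rfl, he⟩ <;>
      rcases of_base_covBy hy with ⟨b, rfl, hb⟩ | ⟨e', rfl, he'⟩
      · rw [base_inf_base] at hz
        obtain rfl := base_injective hz
        rw [base_sup_base]
        exact base_covBy_base (IsWeakUpperModularLattice.covBy_sup_of_inf_covBy_covBy ha hb) hno
      · subst he'
        rw [base_sup_eye ha.lt (hcov _ _ ha).le]
        exact base_covBy_base (hcov _ _ ha) hno
      · subst he
        rw [sup_comm, base_sup_eye hb.lt (hcov _ _ hb).le]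
        exact eye_covBy_base e
      · exact absurd (congrArg eye (ho (he.trans he'.symm))) hxy

end WithEyes

/-! ### The slim semimodular lattice of a coloured chain -/

/-- A chain `0 < 1 < ⋯ < m` whose edges `s < s + 1` (the strips) are coloured by the elements of
an ordered set `P`. Each `p : P` has a distinguished strip `pos p` of its own colour; it heads a
block of strips that extends to the next distinguished strip, and the colours in this block are
the elements below `p`. -/
structure Strips (P : Type*) [PartialOrder P] where
  m : ℕ
  pos : P → ℕ
  col : Fin m → P
  pos_lt : ∀ p, pos p < m
  col_pos : ∀ p, col ⟨pos p, pos_lt p⟩ = p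
  pos_col_le : ∀ s, pos (col s) ≤ s
  sep : ∀ s, pos (col s) < s → ∃ q, pos (col s) < pos q ∧ pos q ≤ s
  col_le : ∀ (s : Fin m) (q : P), pos q ≤ s → (∀ r, pos r ≤ s → pos r ≤ pos q) → col s ≤ q
  exists_strip : ∀ p q, p ≤ q →
    ∃ s : Fin m, col s = p ∧ pos q ≤ s ∧ ∀ r, pos r ≤ s → pos r ≤ pos q

namespace Strips

variable {P : Type*} [PartialOrder P] (A : Strips P)

/-- The points of the chain at which a block begins or the last block ends. -/
def IsHead (c : ℕ) : Prop := A.m ≤ c ∨ ∃ p, A.pos p = c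

theorem exists_head (a : ℕ) : ∃ c, a ≤ c ∧ A.IsHead c := ⟨max a A.m, by omega, .inl (by omega)⟩

open Classical in
/-- The least head above a point. -/
noncomputable def next (a : ℕ) : ℕ := Nat.find (A.exists_head a)

theorem le_next (a : ℕ) : a ≤ A.next a := by
  classical exact (Nat.find_spec (A.exists_head a)).1

theorem isHead_next (a : ℕ) : A.IsHead (A.next a) := by
  classical exact (Nat.find_spec (A.exists_head a)).2

theorem next_le {a c : ℕ} (h : a ≤ c) (hc : A.IsHead c) : A.next a ≤ c := by
  classical exact Nat.find_min' (A.exists_head a) ⟨h, hc⟩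

theorem isHead_pos (p : P) : A.IsHead (A.pos p) := .inr ⟨p, rfl⟩

theorem pos_injective : Function.Injective A.pos := fun p q h => by
  rw [← A.col_pos p, ← A.col_pos q]
  congr 1
  exact Fin.ext h

theorem isHead_zero : A.IsHead 0 := by
  rcases Nat.eq_zero_or_pos A.m with h | h
  · exact .inl h.le
  · exact .inr ⟨A.col ⟨0, h⟩, Nat.le_zero.1 (A.pos_col_le ⟨0, h⟩)⟩

/-- The points of the square of the chain that lie on the diagonal or on a line starting at a
head. They are closed under componentwise meets. -/
@[ext]
structure Grid where
  x : ℕ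
  y : ℕ
  hx : x ≤ A.m
  hy : y ≤ A.m
  h : x = y ∨ A.IsHead (min x y)

namespace Grid

variable {A}

instance : PartialOrder A.Grid :=
  PartialOrder.lift (fun z => (z.x, z.y)) fun z w h => by
    simp only [Prod.mk.injEq] at h
    exact Grid.ext h.1 h.2

theorem le_def {z w : A.Grid} : z ≤ w ↔ z.x ≤ w.x ∧ z.y ≤ w.y := Iff.rfl

theorem lt_def {z w : A.Grid} : z < w ↔ z.x ≤ w.x ∧ z.y ≤ w.y ∧ (z.x < w.x ∨ z.y < w.y) := by
  rw [lt_iff_le_not_ge, le_def, le_def]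
  omega

/-- The least element of the grid above a point of the square. -/
noncomputable def closure (a b : ℕ) (ha : a ≤ A.m) (hb : b ≤ A.m) : A.Grid where
  x := max a (min (A.next a) b)
  y := max b (min (A.next b) a)
  hx := by omega
  hy := by omega
  h := by
    have h1 := A.le_next a
    have h2 := A.le_next b
    by_cases h3 : a < b ∧ A.next a ≤ b
    · right
      convert A.isHead_next a using 1
      omega
    by_cases h4 : b < a ∧ A.next b ≤ a
    · right
      convert A.isHead_next b using 1
      omega
    · left
      omega

/-- Off the diagonal the smaller coordinate is itself a head above `a`. This is what lets `closure`
raise the smaller coordinate to the next head or to the diagonal. -/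
theorem next_le_min (z : A.Grid) {a : ℕ} (h1 : a ≤ z.x) (h2 : a ≤ z.y) :
    z.x = z.y ∨ (A.next a ≤ z.x ∧ A.next a ≤ z.y) := by
  rcases z.h with h | h
  · exact .inl h
  · have := A.next_le (le_min h1 h2) h
    omega

theorem closure_le {a b : ℕ} {ha : a ≤ A.m} {hb : b ≤ A.m} {z : A.Grid} :
    closure a b ha hb ≤ z ↔ a ≤ z.x ∧ b ≤ z.y := by
  simp only [le_def, closure]
  constructor
  · omega
  · rintro ⟨h1, h2⟩
    rcases le_total a b with h | h
    · have := z.next_le_min h1 (h.trans h2)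
      omega
    · have := z.next_le_min (h.trans h1) h2
      omega

noncomputable instance : Lattice A.Grid where
  sup z w := closure (max z.x w.x) (max z.y w.y) (max_le z.hx w.hx) (max_le z.hy w.hy)
  inf z w :=
    { x := min z.x w.x
      y := min z.y w.y
      hx := (min_le_left _ _).trans z.hx
      hy := (min_le_left _ _).trans z.hy
      h := by
        have h1 := z.h
        have h2 := w.h
        by_cases h3 : min z.x z.y ≤ min w.x w.y
        · rcases h1 with h1 | h1
          · left; omega
          · right
            convert h1 using 1
            omega
        · rcases h2 with h2 | h2
          · left; omega
          · right
            convert h2 using 1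
            omega }
  le_sup_left z w := by simp only [le_def, closure]; omega
  le_sup_right z w := by simp only [le_def, closure]; omega
  sup_le z w v h1 h2 := by
    rw [closure_le]
    rw [le_def] at h1 h2
    omega
  inf_le_left z w := by simp only [le_def]; omega
  inf_le_right z w := by simp only [le_def]; omega
  le_inf z w v h1 h2 := by
    simp only [le_def] at *
    omega

theorem sup_x (z w : A.Grid) :
    (z ⊔ w).x = max (max z.x w.x) (min (A.next (max z.x w.x)) (max z.y w.y)) := rfl

theorem sup_y (z w : A.Grid) :
    (z ⊔ w).y = max (max z.y w.y) (min (A.next (max z.y w.y)) (max z.x w.x)) := rfl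

theorem inf_x (z w : A.Grid) : (z ⊓ w).x = min z.x w.x := rfl

theorem inf_y (z w : A.Grid) : (z ⊓ w).y = min z.y w.y := rfl

theorem next_eq {a : ℕ} (h : A.IsHead a) : A.next a = a :=
  le_antisymm (A.next_le le_rfl h) (A.le_next a)

/-- A covering square `z < u, v < w` on or to the left of the diagonal. -/
structure IsLeftCell (z u v w : A.Grid) : Prop where
  le : z.y ≤ z.x
  head : A.IsHead z.y
  ux : u.x = z.x + 1
  uy : u.y = z.y
  vx : v.x = z.x
  vy : v.y = max (z.y + 1) (min (A.next (z.y + 1)) z.x)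
  wx : w.x = z.x + 1
  wy : w.y = min (A.next (z.y + 1)) (z.x + 1)

/-- A covering square `z < u, v < w` to the right of the diagonal. -/
structure IsRightCell (z u v w : A.Grid) : Prop where
  lt : z.x < z.y
  head : A.IsHead z.x
  ux : u.x = min (A.next (z.x + 1)) z.y
  uy : u.y = z.y
  vx : v.x = z.x
  vy : v.y = z.y + 1
  wx : w.x = min (A.next (z.x + 1)) (z.y + 1)
  wy : w.y = z.y + 1

/-- An element strictly above `z` exceeds it in some coordinate, hence lies above the closure of one
of the two unit steps. So there are at most two covers. -/
theorem eq_closure_of_covBy {z w : A.Grid} (h : z ⋖ w) :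
    (∃ hx, w = closure (z.x + 1) z.y hx z.hy) ∨ ∃ hy, w = closure z.x (z.y + 1) z.hx hy := by
  have h1 := lt_def.1 h.lt
  have hwx := w.hx
  have hwy := w.hy
  have aux : ∀ {a b : ℕ} {ha hb}, z.x ≤ a → z.y ≤ b → (z.x < a ∨ z.y < b) → a ≤ w.x → b ≤ w.y →
      w = closure a b ha hb := by
    intro a b ha hb h1 h2 h3 h4 h5
    have h6 : closure a b ha hb ≤ w := closure_le.2 ⟨h4, h5⟩
    have h7 : z < closure a b ha hb := by
      rw [lt_def]
      simp only [closure]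
      omega
    exact ((h.eq_or_eq h7.le h6).resolve_left h7.ne').symm
  by_cases h2 : z.x < w.x
  · exact .inl ⟨by omega, aux (by omega) (by omega) (by omega) (by omega) (by omega)⟩
  · exact .inr ⟨by omega, aux (by omega) (by omega) (by omega) (by omega) (by omega)⟩

theorem isLeftCell_closure {z : A.Grid} (h1 : z.y ≤ z.x) (h2 : A.IsHead z.y) (h3 : z.x < A.m) :
    IsLeftCell z (closure (z.x + 1) z.y h3 z.hy) (closure z.x (z.y + 1) z.hx (by omega))
      (closure (z.x + 1) (z.y + 1) h3 (by omega)) := by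
  have h4 := next_eq h2
  have h5 := A.le_next (z.x + 1)
  have h6 := A.le_next (z.y + 1)
  have h7 := A.le_next z.x
  have h8 : z.x = z.y → A.next z.x = z.y := fun e => by rw [e, h4]
  have h9 : z.x = z.y → A.next (z.x + 1) = A.next (z.y + 1) := fun e => by rw [e]
  constructor <;> first | assumption | (simp only [closure] <;> omega)

theorem isRightCell_closure {z : A.Grid} (h1 : z.x < z.y) (h2 : A.IsHead z.x) (h3 : z.y < A.m) :
    IsRightCell z (closure (z.x + 1) z.y (by omega) z.hy) (closure z.x (z.y + 1) z.hx h3)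
      (closure (z.x + 1) (z.y + 1) (by omega) h3) := by
  have h4 := next_eq h2
  have h5 := A.le_next (z.y + 1)
  have h6 := A.le_next (z.x + 1)
  have h7 := A.le_next z.y
  constructor <;> first | assumption | (simp only [closure]; omega)

theorem isCell_of_covBy {z u v : A.Grid} (hu : z ⋖ u) (hv : z ⋖ v) (huv : u ≠ v) :
    (IsLeftCell z u v (u ⊔ v) ∨ IsRightCell z u v (u ⊔ v)) ∨
      (IsLeftCell z v u (v ⊔ u) ∨ IsRightCell z v u (v ⊔ u)) := by
  have main : ∀ hx hy, closure (z.x + 1) z.y hx z.hy ≠ closure z.x (z.y + 1) z.hx hy →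
      IsLeftCell z (closure (z.x + 1) z.y hx z.hy) (closure z.x (z.y + 1) z.hx hy)
          (closure (z.x + 1) z.y hx z.hy ⊔ closure z.x (z.y + 1) z.hx hy) ∨
        IsRightCell z (closure (z.x + 1) z.y hx z.hy) (closure z.x (z.y + 1) z.hx hy)
          (closure (z.x + 1) z.y hx z.hy ⊔ closure z.x (z.y + 1) z.hx hy) := by
    intro hx hy hne
    have e : closure (z.x + 1) z.y hx z.hy ⊔ closure z.x (z.y + 1) z.hx hy =
        closure (z.x + 1) (z.y + 1) hx hy := by
      apply le_antisymm
      · apply sup_le <;> rw [closure_le] <;> simp only [closure] <;> omega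
      · have h1 : closure (z.x + 1) z.y hx z.hy ≤
          closure (z.x + 1) z.y hx z.hy ⊔ closure z.x (z.y + 1) z.hx hy := le_sup_left
        have h2 : closure z.x (z.y + 1) z.hx hy ≤
          closure (z.x + 1) z.y hx z.hy ⊔ closure z.x (z.y + 1) z.hx hy := le_sup_right
        rw [closure_le] at h1 h2 ⊢
        exact ⟨h1.1, h2.2⟩
    rw [e]
    -- At a diagonal point that is not a head both unit steps close up to the next diagonal point,
    -- so there is only one cover.
    by_cases hd : z.x = z.y ∧ ¬ A.IsHead z.y
    · exfalso
      apply hne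
      have h1 := A.isHead_next z.x
      have h2 := A.le_next z.x
      have h3 : z.x ≠ A.next z.x := fun h => hd.2 (by rw [← hd.1, h]; exact h1)
      have h4 : A.next z.x = A.next z.y := by rw [hd.1]
      ext <;> simp only [closure] <;> omega
    · rcases lt_or_ge z.x z.y with h | h
      · right
        have h1 : A.IsHead z.x := by
          rcases z.h with h' | h'
          · omega
          · rwa [min_eq_left h.le] at h'
        exact isRightCell_closure h h1 (by omega)
      · left
        have h1 : A.IsHead z.y := by
          rcases z.h with h' | h'
          · by_contra h2; exact hd ⟨h', h2⟩
          · rwa [min_eq_right h] at h'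
        exact isLeftCell_closure h h1 (by omega)
  rcases eq_closure_of_covBy hu with ⟨hx, rfl⟩ | ⟨hx, rfl⟩ <;>
  rcases eq_closure_of_covBy hv with ⟨hy, rfl⟩ | ⟨hy, rfl⟩
  · exact absurd rfl huv
  · exact .inl (main hx hy huv)
  · exact .inr (main hy hx huv.symm)
  · exact absurd rfl huv

theorem covBy_of_forall {u w : A.Grid} (h : u < w)
    (h' : ∀ c : A.Grid, u ≤ c → c ≤ w → c ≤ u ∨ w ≤ c) : u ⋖ w :=
  ⟨h, fun c h1 h2 => (h' c h1.le h2.le).elim h1.not_ge h2.not_ge⟩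

theorem IsLeftCell.covBy_left {z u v w : A.Grid} (h : IsLeftCell z u v w) : u ⋖ w := by
  obtain ⟨h1, h2, h3, h4, h5, h6, h7, h8⟩ := h
  have h9 := A.le_next (z.y + 1)
  refine covBy_of_forall (by rw [lt_def]; omega) fun c hc hc' => ?_
  simp only [le_def] at *
  by_cases h10 : z.y + 1 ≤ c.y
  · have := c.next_le_min (a := z.y + 1) (by omega) h10
    omega
  · omega

theorem IsLeftCell.covBy_right {z u v w : A.Grid} (h : IsLeftCell z u v w) : v ⋖ w := by
  obtain ⟨h1, h2, h3, h4, h5, h6, h7, h8⟩ := h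
  have h9 := A.le_next (z.y + 1)
  refine covBy_of_forall (by rw [lt_def]; omega) fun c hc hc' => ?_
  simp only [le_def] at *
  have := c.next_le_min (a := z.y + 1)
  omega

theorem IsRightCell.covBy_left {z u v w : A.Grid} (h : IsRightCell z u v w) : u ⋖ w := by
  obtain ⟨h1, h2, h3, h4, h5, h6, h7, h8⟩ := h
  have h9 := A.le_next (z.x + 1)
  refine covBy_of_forall (by rw [lt_def]; omega) fun c hc hc' => ?_
  simp only [le_def] at *
  have := c.next_le_min (a := z.x + 1)
  omega

theorem IsRightCell.covBy_right {z u v w : A.Grid} (h : IsRightCell z u v w) : v ⋖ w := by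
  obtain ⟨h1, h2, h3, h4, h5, h6, h7, h8⟩ := h
  have h9 := A.le_next (z.x + 1)
  refine covBy_of_forall (by rw [lt_def]; omega) fun c hc hc' => ?_
  simp only [le_def] at *
  have := c.next_le_min (a := z.x + 1)
  omega

instance : IsWeakUpperModularLattice A.Grid where
  covBy_sup_of_inf_covBy_covBy {u v} hu hv := by
    have huv : u ≠ v := by
      rintro rfl
      exact hu.ne (inf_idem u)
    rcases isCell_of_covBy hu hv huv with (h | h) | (h | h)
    · exact h.covBy_left
    · exact h.covBy_left
    · rw [sup_comm]; exact h.covBy_right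
    · rw [sup_comm]; exact h.covBy_right

/-- The diagonal and the two families of lines that start at a head exhaust the grid. -/
theorem exists_injective_grid (A : Strips P) :
    ∃ g : A.Grid → Fin (A.m + 1) ⊕ (P × Fin (A.m + 1)) ⊕ (P × Fin (A.m + 1)),
      Function.Injective g := by
  let F : Fin (A.m + 1) ⊕ (P × Fin (A.m + 1)) ⊕ (P × Fin (A.m + 1)) → ℕ × ℕ :=
    Sum.elim (fun a => (a, a)) (Sum.elim (fun p => (A.pos p.1, p.2)) fun p => (p.2, A.pos p.1))
  have hF : ∀ z : A.Grid, ∃ s, F s = (z.x, z.y) := by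
    intro z
    have h1 := z.hx
    have h2 := z.hy
    by_cases hd : z.x = z.y
    · exact ⟨.inl ⟨z.x, by omega⟩, by simp [F, hd]⟩
    -- A head not below `m` contributes only the corner `(m, m)`, which is on the diagonal.
    rcases z.h with h | h | ⟨p, hp⟩
    · exact absurd h hd
    · omega
    · rcases le_total z.x z.y with h | h
      · exact ⟨.inr (.inl (p, ⟨z.y, by omega⟩)), by simp [F, hp, h]⟩
      · exact ⟨.inr (.inr (p, ⟨z.x, by omega⟩)), by simp [F, hp, h]⟩
  choose g hg using hF
  refine ⟨g, fun z w h => ?_⟩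
  have h1 := (hg z).symm.trans ((congrArg F h).trans (hg w))
  simp only [Prod.mk.injEq] at h1
  exact Grid.ext h1.1 h1.2

instance [Finite P] : Finite A.Grid :=
  let ⟨_, hg⟩ := exists_injective_grid A
  Finite.of_injective _ hg

theorem card_grid_le [Finite P] (A : Strips P) :
    Nat.card A.Grid ≤ (A.m + 1) + 2 * (Nat.card P * (A.m + 1)) := by
  obtain ⟨g, hg⟩ := exists_injective_grid A
  have := Nat.card_le_card_of_injective g hg
  simp only [Nat.card_sum, Nat.card_prod, Nat.card_fin] at this
  omega

end Grid
end Strips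

/-! ### The lattice with eyes: semimodularity, size and planarity -/

namespace Strips

variable {P : Type*} [PartialOrder P] (A : Strips P)

open Grid

/-- The bottom of the cell in which the strip `s` on the left meets, on the right, the strip or
block of strips of its own colour. -/
def eyeBot (s : Fin A.m) : A.Grid where
  x := s
  y := A.pos (A.col s)
  hx := s.2.le
  hy := (A.pos_lt _).le
  h := .inr (by rw [min_eq_right (A.pos_col_le s)]; exact A.isHead_pos _)

/-- The top of the cell with bottom `eyeBot s`. -/
noncomputable def eyeTop (s : Fin A.m) : A.Grid :=
  closure (s + 1) (A.pos (A.col s) + 1) s.2 (A.pos_lt _)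

variable {A}

@[simp] theorem eyeBot_x (s : Fin A.m) : (A.eyeBot s).x = s := rfl

@[simp] theorem eyeBot_y (s : Fin A.m) : (A.eyeBot s).y = A.pos (A.col s) := rfl

theorem eyeTop_le {s : Fin A.m} {z : A.Grid} :
    A.eyeTop s ≤ z ↔ (s : ℕ) + 1 ≤ z.x ∧ A.pos (A.col s) + 1 ≤ z.y := closure_le

theorem exists_isLeftCell_eye (s : Fin A.m) :
    ∃ hx hy, IsLeftCell (A.eyeBot s) (closure (s + 1) (A.pos (A.col s)) s.2 hx)
      (closure s (A.pos (A.col s) + 1) hy (A.pos_lt _)) (A.eyeTop s) :=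
  ⟨_, _, isLeftCell_closure (z := A.eyeBot s) (A.pos_col_le s) (A.isHead_pos _) s.2⟩

theorem eyeTop_x (s : Fin A.m) : (A.eyeTop s).x = s + 1 := by
  obtain ⟨_, _, h⟩ := exists_isLeftCell_eye s
  exact h.wx

theorem eyeTop_y (s : Fin A.m) :
    (A.eyeTop s).y = min (A.next (A.pos (A.col s) + 1)) (s + 1) := by
  obtain ⟨_, _, h⟩ := exists_isLeftCell_eye s
  exact h.wy

theorem eyeBot_lt_eyeTop (s : Fin A.m) : A.eyeBot s < A.eyeTop s := by
  rw [lt_def, eyeTop_x, eyeTop_y]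
  have := A.pos_col_le s
  have := A.le_next (A.pos (A.col s) + 1)
  simp only [eyeBot_x, eyeBot_y]
  omega

instance : Fact (∀ s, A.eyeBot s < A.eyeTop s) := ⟨eyeBot_lt_eyeTop⟩

theorem eyeBot_injective : Function.Injective A.eyeBot := fun _ _ h =>
  Fin.ext (congrArg Grid.x h)

theorem covBy_eyeTop (s : Fin A.m) (z : A.Grid) (h : A.eyeBot s ⋖ z) : z ⋖ A.eyeTop s := by
  obtain ⟨_, _, hc⟩ := exists_isLeftCell_eye s
  rcases eq_closure_of_covBy h with ⟨_, rfl⟩ | ⟨_, rfl⟩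
  · exact hc.covBy_left
  · exact hc.covBy_right

theorem not_eyeBot_covBy_eyeTop (s : Fin A.m) : ¬ A.eyeBot s ⋖ A.eyeTop s := by
  intro h
  obtain ⟨_, _, hc⟩ := exists_isLeftCell_eye s
  refine h.2 ?_ hc.covBy_left.lt
  rw [lt_def, hc.ux, hc.uy]
  omega

variable (A) in
/-- The planar semimodular lattice constructed from the coloured chain. -/
abbrev Lat : Type := WithEyes A.eyeBot A.eyeTop

instance : IsWeakUpperModularLattice A.Lat :=
  WithEyes.isWeakUpperModularLattice eyeBot_injective covBy_eyeTop not_eyeBot_covBy_eyeTop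

theorem card_lat_le [Finite P] (A : Strips P) :
    Nat.card A.Lat ≤ (A.m + 1) + 2 * (Nat.card P * (A.m + 1)) + A.m := by
  rw [Nat.card_congr (WithEyes.equivSum A.eyeBot A.eyeTop), Nat.card_sum, Nat.card_fin]
  exact Nat.add_le_add_right (card_grid_le A) _

theorem eye_offset_lt {s s' : ℕ} : (1 : ℝ) / (s + 2) < 1 / (s' + 2) ↔ s' < s := by
  rw [one_div_lt_one_div (by positivity) (by positivity)]
  constructor
  · intro h
    exact_mod_cast (by linarith : (s' : ℝ) < s)
  · intro h
    have : (s' : ℝ) < s := by exact_mod_cast h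
    linarith

/-- The position of an element in the plane. Eyes that lie between the same two horizontal lines
are placed so that they are incomparable. -/
noncomputable def position : A.Lat → ℝ × ℝ
  | .base z => (z.x, z.y)
  | .eye s => (s + 1 / 2, A.pos (A.col s) + 1 / ((s : ℕ) + 2))

/-- Offsets strictly between 0 and 1 do not affect comparisons with grid points. For eyes over the
same head the vertical offset decreases as `s` grows, so they are incomparable. -/
theorem position_le {u v : A.Lat} : position u ≤ position v ↔ u ≤ v := by
  have off_pos : ∀ s : Fin A.m, (0 : ℝ) < 1 / ((s : ℕ) + 2) := fun s => by positivity
  have off_lt : ∀ s : Fin A.m, (1 : ℝ) / ((s : ℕ) + 2) < 1 := fun s => by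
    rw [div_lt_one (by positivity)]
    have : (0 : ℝ) ≤ (s : ℕ) := Nat.cast_nonneg _
    linarith
  have le_half : ∀ {a b : ℕ} {r : ℝ}, 0 < r → r < 1 → ((a : ℝ) ≤ b + r ↔ a ≤ b) := by
    intro a b r h0 h1
    constructor
    · intro h
      have : (a : ℝ) < (b + 1 : ℕ) := by push_cast; linarith
      exact Nat.lt_succ_iff.1 (by exact_mod_cast this)
    · intro h
      have : (a : ℝ) ≤ b := by exact_mod_cast h
      linarith
  have half_le : ∀ {a b : ℕ} {r : ℝ}, 0 < r → r < 1 → ((b : ℝ) + r ≤ a ↔ b + 1 ≤ a) := by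
    intro a b r h0 h1
    constructor
    · intro h
      have : (b : ℝ) < a := by linarith
      exact_mod_cast this
    · intro h
      have : ((b + 1 : ℕ) : ℝ) ≤ a := by exact_mod_cast h
      push_cast at this
      linarith
  rcases u with z | s <;> rcases v with w | s'
  · rw [WithEyes.base_le_base, le_def]
    simp [position, Prod.le_def]
  · rw [WithEyes.base_le, WithEyes.lo_eye, le_def]
    simp only [position, Prod.le_def, eyeBot_x, eyeBot_y]
    rw [le_half (by norm_num) (by norm_num), le_half (off_pos s') (off_lt s')]
  · rw [WithEyes.le_base, WithEyes.hi_eye, eyeTop_le]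
    simp only [position, Prod.le_def]
    rw [half_le (by norm_num) (by norm_num), half_le (off_pos s) (off_lt s)]
  · rw [WithEyes.eye_le_eye, eyeTop_le]
    simp only [position, Prod.le_def, eyeBot_x, eyeBot_y]
    constructor
    · rintro ⟨h1, h2⟩
      have h3 : (s : ℕ) ≤ s' := by
        have : ((s : ℕ) : ℝ) ≤ (s' : ℕ) := by linarith
        exact_mod_cast this
      rcases h3.eq_or_lt with h4 | h4
      · exact .inl (Fin.ext h4)
      · right
        have h5 := eye_offset_lt.2 h4
        have h6 : ((A.pos (A.col s) : ℕ) : ℝ) < A.pos (A.col s') := by linarith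
        exact ⟨h4, by exact_mod_cast h6⟩
    · rintro (rfl | ⟨h1, h2⟩)
      · exact ⟨le_rfl, le_rfl⟩
      · have h3 : (((s : ℕ) + 1 : ℕ) : ℝ) ≤ (s' : ℕ) := by exact_mod_cast h1
        have h4 : ((A.pos (A.col s) + 1 : ℕ) : ℝ) ≤ A.pos (A.col s') := by exact_mod_cast h2
        push_cast at h3 h4
        have h5 := off_lt s
        have h6 := off_pos s'
        exact ⟨by linarith, by linarith⟩

theorem isPlanarOrder_lat : IsPlanarOrder A.Lat :=
  isPlanarOrder_of_orderEmbedding (OrderEmbedding.ofMapLEIff position fun _ _ => position_le)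

end Strips

/-! ### From lower sets of colours to congruences -/

namespace Strips

variable {P : Type*} [PartialOrder P] {A : Strips P}

open Grid
open WithEyes hiding le_def

theorem eye_le_base {s : Fin A.m} {z : A.Grid} :
    (eye s : A.Lat) ≤ base z ↔ (s : ℕ) + 1 ≤ z.x ∧ A.pos (A.col s) + 1 ≤ z.y :=
  le_base.trans eyeTop_le

variable (A) in
/-- The points of the left boundary chain. -/
def leftPt (a : ℕ) (ha : a ≤ A.m) : A.Grid :=
  ⟨a, 0, ha, Nat.zero_le _, .inr (by rw [Nat.min_zero]; exact A.isHead_zero)⟩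

variable (A) in
/-- The points of the right boundary chain. -/
def rightPt (b : ℕ) (hb : b ≤ A.m) : A.Grid :=
  ⟨0, b, Nat.zero_le _, hb, .inr (by rw [Nat.zero_min]; exact A.isHead_zero)⟩

variable (A) in
/-- The points of the diagonal. -/
def diagPt (d : ℕ) (hd : d ≤ A.m) : A.Grid := ⟨d, d, hd, hd, .inl rfl⟩

theorem leftPt_le {a : ℕ} {ha : a ≤ A.m} {z : A.Grid} : A.leftPt a ha ≤ z ↔ a ≤ z.x := by
  simp [le_def, leftPt]

theorem rightPt_le {b : ℕ} {hb : b ≤ A.m} {z : A.Grid} : A.rightPt b hb ≤ z ↔ b ≤ z.y := by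
  simp [le_def, rightPt]

variable (A) in
/-- The join-irreducible elements whose colour is not in `U`. -/
def irredOutside (U : Set P) : Set A.Lat :=
  {q | ∃ s, A.col s ∉ U ∧
    (q = base (A.leftPt (s + 1) s.2) ∨ q = base (A.rightPt (s + 1) s.2) ∨ q = eye s)}

theorem sameLower_base {U : Set P} {z w : A.Grid} (h : z ≤ w)
    (H : ∀ s : Fin A.m, A.col s ∉ U → ((s : ℕ) + 1 ≤ w.x → (s : ℕ) + 1 ≤ z.x) ∧
      ((s : ℕ) + 1 ≤ w.y → (s : ℕ) + 1 ≤ z.y) ∧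
      ((s : ℕ) + 1 ≤ w.x → A.pos (A.col s) + 1 ≤ w.y → A.pos (A.col s) + 1 ≤ z.y)) :
    sameLower (A.irredOutside U) (base z) (base w) := by
  apply sameLower_of_le (base_le_base.2 h)
  rintro q ⟨s, hs, rfl | rfl | rfl⟩
  · rw [base_le_base, base_le_base, leftPt_le, leftPt_le]
    exact (H s hs).1
  · rw [base_le_base, base_le_base, rightPt_le, rightPt_le]
    exact (H s hs).2.1
  · rw [eye_le_base, eye_le_base]
    exact fun h => ⟨(H s hs).1 h.1, (H s hs).2.2 h.1 h.2⟩

theorem mem_of_sameLower_left {U : Set P} {x y : A.Lat} (h : sameLower (A.irredOutside U) x y)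
    (s : Fin A.m) (h1 : ¬ (s : ℕ) + 1 ≤ x.lo.x) (h2 : (s : ℕ) + 1 ≤ y.lo.x) : A.col s ∈ U := by
  by_contra hs
  have := (h _ ⟨s, hs, .inl rfl⟩).2 (base_le.2 (leftPt_le.2 h2))
  exact h1 (leftPt_le.1 (base_le.1 this))

theorem mem_of_sameLower_right {U : Set P} {x y : A.Lat} (h : sameLower (A.irredOutside U) x y)
    (s : Fin A.m) (h1 : ¬ (s : ℕ) + 1 ≤ x.lo.y) (h2 : (s : ℕ) + 1 ≤ y.lo.y) : A.col s ∈ U := by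
  by_contra hs
  have := (h _ ⟨s, hs, .inr (.inl rfl)⟩).2 (base_le.2 (rightPt_le.2 h2))
  exact h1 (rightPt_le.1 (base_le.1 this))

theorem mem_of_sameLower_eye {U : Set P} {x y : A.Lat} (h : sameLower (A.irredOutside U) x y)
    (s : Fin A.m) (h1 : ¬ eye s ≤ x) (h2 : eye s ≤ y) : A.col s ∈ U := by
  by_contra hs
  exact h1 ((h _ ⟨s, hs, .inr (.inr rfl)⟩).2 h2)

theorem col_le_of_lt_next {s : Fin A.m} {p : P} (h1 : A.pos p ≤ s)
    (h2 : (s : ℕ) < A.next (A.pos p + 1)) : A.col s ≤ p := by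
  refine A.col_le s p h1 fun r hr => ?_
  by_contra h
  have := A.next_le (by omega) (A.isHead_pos r) (a := A.pos p + 1)
  omega

theorem pos_le_of_lt_next {q p : P} (h : A.pos q < A.next (A.pos p + 1)) :
    A.pos q ≤ A.pos p := by
  by_contra h'
  have := A.next_le (by omega) (A.isHead_pos q) (a := A.pos p + 1)
  omega

theorem col_of_eq_pos {s : Fin A.m} {p : P} (h : A.pos p = s) : A.col s = p := by
  rw [← A.col_pos p]
  congr 1
  exact Fin.ext h.symm

theorem exists_pos_eq {c : ℕ} (h : A.IsHead c) (hc : c < A.m) : ∃ p, A.pos p = c :=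
  h.resolve_left (by omega)

/-- Opposite sides of a covering square of the grid have the same colour, and so have all the
edges of a square that contains an eye. -/
theorem exists_cell_colors {z u v w : A.Grid} (h : IsLeftCell z u v w ∨ IsRightCell z u v w) :
    ∃ p q : P, (∀ s, A.eyeBot s = z → A.col s = p ∧ A.col s = q) ∧ ∀ U : LowerSet P,
      (sameLower (A.irredOutside U) (base z) (base u) → p ∈ U) ∧
      (sameLower (A.irredOutside U) (base z) (base v) → q ∈ U) ∧
      (p ∈ U → sameLower (A.irredOutside U) (base v) (base w)) ∧
      (q ∈ U → sameLower (A.irredOutside U) (base u) (base w)) := by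
  have hwm := w.hx
  have hwm' := w.hy
  rcases h with ⟨h1, h2, h3, h4, h5, h6, h7, h8⟩ | ⟨h1, h2, h3, h4, h5, h6, h7, h8⟩
  · have hz : z.x < A.m := by omega
    obtain ⟨q, hq⟩ := exists_pos_eq h2 (by omega)
    have hnext := A.le_next (z.y + 1)
    refine ⟨A.col ⟨z.x, hz⟩, q, ?_, fun U => ⟨fun h => ?_, fun h => ?_, fun hp => ?_, fun hq' => ?_⟩⟩
    · rintro s rfl
      exact ⟨rfl, A.pos_injective hq.symm⟩
    · exact mem_of_sameLower_left h ⟨z.x, hz⟩ (by simp) (by simp [h3])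
    · have := mem_of_sameLower_right h ⟨z.y, by omega⟩ (by simp) (by simp; omega)
      rwa [col_of_eq_pos (p := q) hq] at this
    -- Beside the diagonal the edge from `v` to `w` may raise both coordinates, but then both cross
    -- the same strip `z.x`.
    · refine sameLower_base (by rw [le_def]; omega) fun s hs => ?_
      have hne : (s : ℕ) ≠ z.x := by
        rintro h
        exact hs (by rwa [show s = ⟨z.x, hz⟩ from Fin.ext h])
      have := A.pos_col_le s
      omega
    · refine sameLower_base (by rw [le_def]; omega) fun s hs => ?_
      rw [← hq] at h8 h4
      -- The edge from `u` to `w` crosses strips of the block of `q` only; their colours are below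
      -- `q`, so they lie in the lower set `U`. An eye passed on the way has colour `q` itself.
      have h9 : ¬ (A.pos q ≤ s ∧ (s : ℕ) < A.next (A.pos q + 1)) := fun h =>
        hs (U.lower (col_le_of_lt_next h.1 h.2) hq')
      have h10 : A.pos (A.col s) ≠ A.pos q := fun h => hs (by rwa [A.pos_injective h])
      have h11 := pos_le_of_lt_next (A := A) (q := A.col s) (p := q)
      omega
  · have hz : z.y < A.m := by omega
    obtain ⟨p, hp⟩ := exists_pos_eq h2 (by omega)
    have hnext := A.le_next (z.x + 1)
    refine ⟨p, A.col ⟨z.y, hz⟩, ?_, fun U => ⟨fun h => ?_, fun h => ?_, fun hp' => ?_, fun hq' => ?_⟩⟩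
    · rintro s rfl
      exact absurd h1 (A.pos_col_le s).not_gt
    · have := mem_of_sameLower_left h ⟨z.x, by omega⟩ (by simp) (by simp; omega)
      rwa [col_of_eq_pos (p := p) hp] at this
    · exact mem_of_sameLower_right h ⟨z.y, hz⟩ (by simp) (by simp [h6])
    · refine sameLower_base (by rw [le_def]; omega) fun s hs => ?_
      rw [← hp] at h7 h5
      have h9 : ¬ (A.pos p ≤ s ∧ (s : ℕ) < A.next (A.pos p + 1)) := fun h =>
        hs (U.lower (col_le_of_lt_next h.1 h.2) hp')
      have := A.pos_col_le s
      omega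
    · refine sameLower_base (by rw [le_def]; omega) fun s hs => ?_
      have hne : (s : ℕ) ≠ z.y := by
        rintro h
        exact hs (by rwa [show s = ⟨z.y, hz⟩ from Fin.ext h])
      have := A.pos_col_le s
      omega

/-- Both directions of the cell have the colour of `s`, so two of its consecutive sides are
collapsed. -/
theorem sameLower_eyeTop {U : LowerSet P} {s : Fin A.m} (hs : A.col s ∈ U) :
    sameLower (A.irredOutside U) (base (A.eyeBot s)) (base (A.eyeTop s)) := by
  obtain ⟨_, _, hc⟩ := exists_isLeftCell_eye s
  obtain ⟨p, q, he, hU⟩ := exists_cell_colors (.inl hc)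
  obtain ⟨rfl, hq⟩ := he s rfl
  obtain ⟨-, -, h1, h2⟩ := hU U
  have h3 := sameLower_inf (base (closure s (A.pos (A.col s) + 1) ‹_› (A.pos_lt _)))
    (h2 (hq ▸ hs))
  rw [base_inf_base, base_inf_base, inf_eq_right.2 hc.covBy_right.le] at h3
  have h4 := (sameLower _).trans h3 (h1 hs)
  convert h4 using 2
  ext
  · rw [inf_x, hc.ux, hc.vx]; simp
  · rw [inf_y, hc.uy, hc.vy]; simp

theorem sameLower_between {S : Type*} [Lattice S] {Q : Set S} {a b x y : S}
    (h : sameLower Q a b) (hax : a ≤ x) (hxy : x ≤ y) (hyb : y ≤ b) : sameLower Q x y :=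
  sameLower_of_le hxy fun q hq hqy => ((h q hq).2 (hqy.trans hyb)).trans hax

/-- Two grid covers span a coloured cell. If one cover is an eye, the related edge has the colour of
the eye, and then its whole diamond is collapsed. -/
theorem sameLower_sup_of_covBy (U : LowerSet P) {z x y : A.Lat} (hx : z ⋖ x) (hy : z ⋖ y)
    (hxy : x ≠ y) (h : sameLower (A.irredOutside U) z x) :
    sameLower (A.irredOutside U) y (x ⊔ y) := by
  cases z with
  | eye e => exact absurd ((eq_of_eye_covBy hx).trans (eq_of_eye_covBy hy).symm) hxy
  | base z =>
    have not_le : ¬ x ≤ base z := hx.lt.not_ge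
    rcases of_base_covBy hx with ⟨a, rfl, ha⟩ | ⟨s, rfl, hs⟩ <;>
    rcases of_base_covBy hy with ⟨b, rfl, hb⟩ | ⟨s', rfl, hs'⟩
    · rw [base_sup_base]
      rcases isCell_of_covBy ha hb (fun e => hxy (congrArg _ e)) with hc | hc
      · obtain ⟨p, q, -, hU⟩ := exists_cell_colors hc
        exact (hU U).2.2.1 ((hU U).1 h)
      · obtain ⟨p, q, -, hU⟩ := exists_cell_colors hc
        rw [sup_comm]
        exact (hU U).2.2.2 ((hU U).2.1 h)
    · subst hs'
      rw [base_sup_eye ha.lt (covBy_eyeTop _ _ ha).le]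
      refine sameLower_between (sameLower_eyeTop (s := s') ?_) hy.le (le_base_hi _) le_rfl
      obtain ⟨_, _, hc⟩ := exists_isLeftCell_eye s'
      obtain ⟨p, q, he, hU⟩ := exists_cell_colors (.inl hc)
      obtain ⟨rfl, hq⟩ := he s' rfl
      rcases eq_closure_of_covBy ha with ⟨_, rfl⟩ | ⟨_, rfl⟩
      · exact (hU U).1 h
      · rw [hq]; exact (hU U).2.1 h
    · subst hs
      rw [sup_comm, base_sup_eye hb.lt (covBy_eyeTop _ _ hb).le]
      exact sameLower_between (sameLower_eyeTop (mem_of_sameLower_eye h s not_le le_rfl)) hy.le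
        (base_le_base.2 (covBy_eyeTop _ _ hb).le) le_rfl
    · exact absurd (congrArg eye (eyeBot_injective (hs.trans hs'.symm))) hxy

variable (A) in
/-- The congruence that collapses exactly the edges with colour in `U`. -/
noncomputable def conOf [Finite P] (U : LowerSet P) : LatticeCon A.Lat :=
  LatticeCon.ofSameLower (A.irredOutside U) (sameLower_sup_of_covBy U)

end Strips

/-! ### From congruences to lower sets of colours -/

namespace LatticeCon

/-- A congruence that collapses one of three edges above `o` in a sublattice `M₃` collapses any
other. -/
theorem r_of_diamond {S : Type*} [Lattice S] (c : LatticeCon S) {o i x y z : S}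
    (hxy : x ⊔ y = i) (hyz : y ⊓ z = o) (hzi : z ≤ i) (hoy : o ≤ y) (h : c.r o x) : c.r o z := by
  refine c.r_of_persp_down (c.r_of_persp h (sup_eq_right.2 hoy) hxy) hyz (inf_eq_right.2 hzi)

end LatticeCon

namespace Strips

variable {P : Type*} [PartialOrder P] {A : Strips P}

open Grid
open WithEyes hiding le_def

theorem base_persp {A : Strips P} (c : LatticeCon A.Lat) {x y u v : A.Grid}
    (h : c.r (base x) (base y)) (hu : x ⊔ u = u) (hv : y ⊔ u = v) : c.r (base u) (base v) :=
  c.r_of_persp h (by rw [base_sup_base, hu]) (by rw [base_sup_base, hv])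

theorem base_persp_down {A : Strips P} (c : LatticeCon A.Lat) {x y u v : A.Grid}
    (h : c.r (base x) (base y)) (hu : x ⊓ v = u) (hv : v ≤ y) : c.r (base u) (base v) :=
  c.r_of_persp_down h (by rw [base_inf_base, hu])
    (by rw [base_inf_base, inf_eq_right.2 hv])

variable (c : LatticeCon A.Lat)

/-- The congruence collapses the edge `s` of the left boundary chain. -/
def CollapsesLeft (s : Fin A.m) : Prop :=
  c.r (base (A.leftPt s s.2.le)) (base (A.leftPt (s + 1) s.2))

/-- The congruence collapses the edge `s` of the right boundary chain. -/
def CollapsesRight (s : Fin A.m) : Prop :=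
  c.r (base (A.rightPt s s.2.le)) (base (A.rightPt (s + 1) s.2))

/-- The strip of its own colour that heads the block of `p`. -/
def headStrip (A : Strips P) (p : P) : Fin A.m := ⟨A.pos p, A.pos_lt p⟩

section Cell

variable (s : Fin A.m)

/-- The left upper cover of `eyeBot s`. -/
noncomputable def eyeLeft : A.Grid :=
  closure (s + 1) (A.pos (A.col s)) s.2 (A.pos_lt _).le

/-- The right upper cover of `eyeBot s`. -/
noncomputable def eyeRight : A.Grid :=
  closure s (A.pos (A.col s) + 1) s.2.le (A.pos_lt _)

theorem isLeftCell_eye : IsLeftCell (A.eyeBot s) (eyeLeft s) (eyeRight s) (A.eyeTop s) :=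
  let ⟨_, _, h⟩ := exists_isLeftCell_eye s
  h

theorem eyeBot_lt_eyeLeft : A.eyeBot s < eyeLeft s := by
  rw [lt_def, (isLeftCell_eye s).ux, (isLeftCell_eye s).uy]
  omega

theorem eyeBot_lt_eyeRight : A.eyeBot s < eyeRight s := by
  rw [lt_def, (isLeftCell_eye s).vx, (isLeftCell_eye s).vy]
  omega

theorem eyeLeft_inf_eyeRight : eyeLeft s ⊓ eyeRight s = A.eyeBot s := by
  have h := isLeftCell_eye s
  ext
  · rw [inf_x, h.ux, h.vx]; omega
  · rw [inf_y, h.uy, h.vy]; omega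

theorem eyeLeft_sup_eyeRight : eyeLeft s ⊔ eyeRight s = A.eyeTop s := by
  have h := isLeftCell_eye s
  apply le_antisymm (sup_le h.covBy_left.le h.covBy_right.le)
  have h1 : eyeLeft s ≤ eyeLeft s ⊔ eyeRight s := le_sup_left
  have h2 : eyeRight s ≤ eyeLeft s ⊔ eyeRight s := le_sup_right
  rw [le_def, h.ux] at h1
  rw [le_def, h.vy] at h2
  rw [eyeTop_le]
  simp only [eyeBot_x, eyeBot_y] at h1 h2
  omega

/-- The eye and the two sides form an `M₃`; `eyeRight` serves as the third atom for the
perspectivities. -/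
theorem r_eyeLeft_iff_eye :
    c.r (base (A.eyeBot s)) (base (eyeLeft s)) ↔ c.r (base (A.eyeBot s)) (eye s) := by
  have h := isLeftCell_eye s
  have hv := eyeBot_lt_eyeRight s
  have e1 : (base (eyeRight s) ⊔ eye s : A.Lat) = _ := base_sup_eye hv h.covBy_right.le
  have e2 : (base (eyeRight s) ⊓ eye s : A.Lat) = _ := base_inf_eye hv.le h.covBy_right.lt
  constructor
  · exact c.r_of_diamond (y := base (eyeRight s)) (i := base (A.eyeTop s))
      (by rw [base_sup_base, eyeLeft_sup_eyeRight]) e2 (eye_covBy_base s).le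
      (base_le_base.2 hv.le)
  · exact c.r_of_diamond (y := base (eyeRight s)) (i := base (A.eyeTop s))
      (by rw [sup_comm, e1]) (by rw [base_inf_base, inf_comm, eyeLeft_inf_eyeRight])
      (base_le_base.2 h.covBy_left.le) (base_le_base.2 hv.le)

theorem r_eyeRight_iff_eye :
    c.r (base (A.eyeBot s)) (base (eyeRight s)) ↔ c.r (base (A.eyeBot s)) (eye s) := by
  have h := isLeftCell_eye s
  have hu := eyeBot_lt_eyeLeft s
  have e1 : (base (eyeLeft s) ⊔ eye s : A.Lat) = _ := base_sup_eye hu h.covBy_left.le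
  have e2 : (base (eyeLeft s) ⊓ eye s : A.Lat) = _ := base_inf_eye hu.le h.covBy_left.lt
  constructor
  · exact c.r_of_diamond (y := base (eyeLeft s)) (i := base (A.eyeTop s))
      (by rw [base_sup_base, sup_comm, eyeLeft_sup_eyeRight]) e2 (eye_covBy_base s).le
      (base_le_base.2 hu.le)
  · exact c.r_of_diamond (y := base (eyeLeft s)) (i := base (A.eyeTop s))
      (by rw [sup_comm, e1]) (by rw [base_inf_base, eyeLeft_inf_eyeRight])
      (base_le_base.2 h.covBy_right.le) (base_le_base.2 hu.le)

theorem collapsesLeft_iff_eyeLeft :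
    CollapsesLeft c s ↔ c.r (base (A.eyeBot s)) (base (eyeLeft s)) := by
  have h := isLeftCell_eye s
  constructor
  · intro hc
    refine base_persp c hc (sup_eq_right.2 (leftPt_le.2 le_rfl)) ?_
    apply le_antisymm
    · exact sup_le (leftPt_le.2 h.ux.ge) (eyeBot_lt_eyeLeft s).le
    · rw [eyeLeft, closure_le, ← leftPt_le (ha := s.2)]
      exact ⟨le_sup_left, (le_def.1 (le_sup_right : A.eyeBot s ≤ _)).2⟩
  · intro hc
    refine base_persp_down c hc ?_ (leftPt_le.2 h.ux.ge)
    ext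
    · rw [inf_x]; simp [leftPt]
    · rw [inf_y]; simp [leftPt]

theorem collapsesRight_iff_eyeRight :
    CollapsesRight c (A.headStrip (A.col s)) ↔
      c.r (base (A.eyeBot s)) (base (eyeRight s)) := by
  have h := isLeftCell_eye s
  have hle : A.pos (A.col s) + 1 ≤ (eyeRight s).y := by rw [h.vy, eyeBot_y]; omega
  constructor
  · intro hc
    refine base_persp c hc (sup_eq_right.2 (rightPt_le.2 le_rfl)) ?_
    apply le_antisymm
    · exact sup_le (rightPt_le.2 hle) (eyeBot_lt_eyeRight s).le
    · rw [eyeRight, closure_le, ← rightPt_le (hb := A.pos_lt (A.col s))]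
      exact ⟨(le_def.1 (le_sup_right : A.eyeBot s ≤ _)).1, le_sup_left⟩
  · intro hc
    refine base_persp_down c hc ?_ (rightPt_le.2 hle)
    ext
    · rw [inf_x]; simp [rightPt]
    · rw [inf_y]; simp [rightPt, headStrip]

theorem collapsesLeft_iff_eye : CollapsesLeft c s ↔ c.r (base (A.eyeBot s)) (eye s) := by
  rw [collapsesLeft_iff_eyeLeft, r_eyeLeft_iff_eye]

theorem collapsesRight_headStrip_iff_eye :
    CollapsesRight c (A.headStrip (A.col s)) ↔ c.r (base (A.eyeBot s)) (eye s) := by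
  rw [collapsesRight_iff_eyeRight, r_eyeRight_iff_eye]

theorem next_eq_succ {d : ℕ} (h : ¬ A.IsHead d) : d + 1 ≤ A.next d :=
  (A.le_next d).lt_of_ne fun e => h (e ▸ A.isHead_next d)

/-- Away from heads the two boundary edges are both perspective to the same diagonal edge. -/
theorem collapsesRight_iff_left_of_not_isHead (hs : ¬ A.IsHead s) :
    CollapsesRight c s ↔ CollapsesLeft c s := by
  have hn := next_eq_succ hs
  constructor
  · intro hc
    have h1 : c.r (base (A.diagPt s s.2.le)) (base (A.diagPt (s + 1) s.2)) := by
      refine base_persp c hc (sup_eq_right.2 (rightPt_le.2 le_rfl)) ?_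
      ext
      · simp only [sup_x, rightPt, diagPt, Nat.zero_max]; omega
      · simp only [sup_y, rightPt, diagPt]; omega
    refine base_persp_down c h1 ?_ (leftPt_le.2 le_rfl)
    ext
    · simp [inf_x, leftPt, diagPt]
    · simp [inf_y, leftPt, diagPt]
  · intro hc
    have h1 : c.r (base (A.diagPt s s.2.le)) (base (A.diagPt (s + 1) s.2)) := by
      refine base_persp c hc (sup_eq_right.2 (leftPt_le.2 le_rfl)) ?_
      ext
      · simp only [sup_x, leftPt, diagPt]; omega
      · simp only [sup_y, leftPt, diagPt, Nat.zero_max]; omega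
    refine base_persp_down c h1 ?_ (rightPt_le.2 le_rfl)
    ext
    · simp [inf_x, rightPt, diagPt]
    · simp [inf_y, rightPt, diagPt]

/-- A head strip meets the left strip with its number in the cell of its own eye; any other strip
crosses over to the left along the diagonal. -/
theorem collapsesRight_iff_eye : CollapsesRight c s ↔ c.r (base (A.eyeBot s)) (eye s) := by
  by_cases h : A.IsHead s
  · obtain ⟨p, hp⟩ := exists_pos_eq h s.2
    obtain rfl := col_of_eq_pos hp
    rw [← collapsesRight_headStrip_iff_eye]
    rw [show A.headStrip (A.col s) = s from Fin.ext hp]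
  · rw [collapsesRight_iff_left_of_not_isHead c s h, collapsesLeft_iff_eye]

end Cell

/-- If a congruence collapses the head strip of a block, it collapses every strip of the block. -/
theorem collapsesRight_of_block {p : P} {s : Fin A.m} (h1 : A.pos p ≤ s)
    (h2 : (s : ℕ) < A.next (A.pos p + 1)) (hc : CollapsesRight c (A.headStrip p)) :
    CollapsesRight c s := by
  have e1 := next_eq (A.isHead_pos p)
  -- Left of the diagonal a step up from the head jumps through the block: after joining with
  -- `leftPt (s + 1)` the second coordinate goes from `pos p` to `s + 1` at once. Meeting with the
  -- right boundary brings this interval back there.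
  have h3 : c.r (base (A.leftPt (s + 1) s.2 ⊔ A.rightPt (A.pos p) (A.pos_lt p).le))
      (base (A.leftPt (s + 1) s.2 ⊔ A.rightPt (A.pos p + 1) (A.pos_lt p))) := by
    rw [← base_sup_base, ← base_sup_base]
    exact c.sup_left hc _
  have h4 : c.r (base (A.rightPt (A.pos p) (A.pos_lt p).le)) (base (A.rightPt (s + 1) s.2)) := by
    refine base_persp_down c h3 ?_ ?_
    · ext
      · simp [inf_x, rightPt]
      · simp only [inf_y, sup_y, leftPt, rightPt, Nat.zero_max, Nat.max_zero, e1]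
        omega
    · rw [rightPt_le]
      simp only [sup_y, leftPt, rightPt, Nat.zero_max, Nat.max_zero]
      omega
  exact c.r_of_between h4 (base_le_base.2 (rightPt_le.2 h1))
    (base_le_base.2 (rightPt_le.2 (Nat.le_succ _))) le_rfl

/-- The colours of the edges that a congruence collapses. -/
def collapsedColors : LowerSet P where
  carrier := {p | CollapsesRight c (A.headStrip p)}
  lower' := by
    intro q p hpq hq
    obtain ⟨s, rfl, h1, h2⟩ := A.exists_strip p q hpq
    -- Otherwise the next head would be a distinguished strip after `pos q` and not after `s`.
    have h3 : (s : ℕ) < A.next (A.pos q + 1) := by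
      by_contra h
      have h4 := A.le_next (A.pos q + 1)
      obtain ⟨r, hr⟩ := exists_pos_eq (A.isHead_next (A.pos q + 1)) (by omega)
      have := h2 r (by omega)
      omega
    have h4 := collapsesRight_of_block c h1 h3 hq
    rw [collapsesRight_iff_eye] at h4
    exact (collapsesRight_headStrip_iff_eye c s).2 h4

theorem mem_collapsedColors {p : P} :
    p ∈ collapsedColors c ↔ CollapsesRight c (A.headStrip p) := Iff.rfl

theorem col_mem_collapsedColors {s : Fin A.m} :
    A.col s ∈ collapsedColors c ↔ c.r (base (A.eyeBot s)) (eye s) := by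
  rw [mem_collapsedColors, collapsesRight_headStrip_iff_eye]

/-- Every element properly below a join-irreducible one is below its lower cover. -/
theorem le_of_lt_leftPt {s : Fin A.m} {w : A.Lat} (h : w < base (A.leftPt (s + 1) s.2)) :
    w ≤ base (A.leftPt s s.2.le) := by
  cases w with
  | base z =>
    rw [base_lt_base, lt_def] at h
    rw [base_le_base, le_def]
    simp only [leftPt] at h ⊢
    omega
  | eye e =>
    have := eye_le_base.1 h.le
    simp [leftPt] at this

theorem le_of_lt_rightPt {s : Fin A.m} {w : A.Lat} (h : w < base (A.rightPt (s + 1) s.2)) :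
    w ≤ base (A.rightPt s s.2.le) := by
  cases w with
  | base z =>
    rw [base_lt_base, lt_def] at h
    rw [base_le_base, le_def]
    simp only [rightPt] at h ⊢
    omega
  | eye e =>
    have := eye_le_base.1 h.le
    simp [rightPt] at this

theorem le_of_lt_eye {s : Fin A.m} {w : A.Lat} (h : w < eye s) : w ≤ base (A.eyeBot s) :=
  le_base.2 ((WithEyes.le_def.1 h.le).resolve_left h.ne)

/-- Here `q` is join-irreducible with lower cover `q'`. If `q ⊓ y` dropped below `q`, then `q ⊓ x =
q` and `q ⊓ y` would be congruent, and the edge from `q'` to `q` would collapse. -/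
theorem le_of_r_of_not_r {S : Type*} [Lattice S] (c : LatticeCon S) {q q' x y : S}
    (hq' : ∀ w < q, w ≤ q') (hle : q' ≤ q) (hn : ¬ c.r q' q) (h : c.r x y) (hx : q ≤ x) :
    q ≤ y := by
  by_contra hy
  have h1 := c.inf_left h q
  rw [inf_eq_left.2 hx] at h1
  exact hn (c.r_of_between (c.symm h1) (hq' _ (inf_le_left.lt_of_ne fun e => hy (inf_eq_left.1 e)))
    hle le_rfl)

theorem sameLower_of_r {x y : A.Lat} (h : c.r x y) :
    sameLower (A.irredOutside (collapsedColors c)) x y := by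
  have main : ∀ x y, c.r x y → ∀ q ∈ A.irredOutside (collapsedColors c), q ≤ x → q ≤ y := by
    rintro x y h q ⟨s, hs, rfl | rfl | rfl⟩
    · exact le_of_r_of_not_r c (fun w => le_of_lt_leftPt)
        (base_le_base.2 (leftPt_le.2 (Nat.le_succ _)))
        (fun hc => hs ((col_mem_collapsedColors c).2 ((collapsesLeft_iff_eye c s).1 hc))) h
    · exact le_of_r_of_not_r c (fun w => le_of_lt_rightPt)
        (base_le_base.2 (rightPt_le.2 (Nat.le_succ _)))
        (fun hc => hs ((col_mem_collapsedColors c).2 ((collapsesRight_iff_eye c s).1 hc))) h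
    · exact le_of_r_of_not_r c (fun w => le_of_lt_eye) (base_lo_le (eye s))
        (fun hc => hs ((col_mem_collapsedColors c).2 hc)) h
  exact fun q hq => ⟨main x y h q hq, main y x (c.symm h) q hq⟩

theorem leftPt_sup_rightPt (z : A.Grid) :
    A.leftPt z.x z.hx ⊔ A.rightPt z.y z.hy = z := by
  apply le_antisymm (sup_le (leftPt_le.2 le_rfl) (rightPt_le.2 le_rfl))
  have h1 : A.leftPt z.x z.hx ≤ A.leftPt z.x z.hx ⊔ A.rightPt z.y z.hy := le_sup_left
  have h2 : A.rightPt z.y z.hy ≤ A.leftPt z.x z.hx ⊔ A.rightPt z.y z.hy := le_sup_right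
  exact ⟨leftPt_le.1 h1, rightPt_le.1 h2⟩

/-- Join to `x` the join-irreducibles below `y`, one at a time: each either is already below `x` or
sits on top of a collapsed edge. -/
theorem r_of_sameLower_of_le {x y : A.Lat}
    (h : sameLower (A.irredOutside (collapsedColors c)) x y) (hxy : x ≤ y) : c.r x y := by
  have step : ∀ (s : Fin A.m) (q' q : A.Lat),
      (q = base (A.leftPt (s + 1) s.2) ∨ q = base (A.rightPt (s + 1) s.2) ∨ q = eye s) →
      (c.r (base (A.eyeBot s)) (eye s) → c.r q' q) → q ≤ y → c.r x (x ⊔ q') → c.r x (x ⊔ q) := by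
    intro s q' q hq hc hqy hx
    by_cases hs : A.col s ∈ collapsedColors c
    · exact c.trans hx (c.sup_left (hc ((col_mem_collapsedColors c).1 hs)) x)
    · rw [sup_eq_left.2 ((h q ⟨s, hs, hq⟩).2 hqy)]
  have hleft : ∀ a ha, base (A.leftPt a ha) ≤ y → c.r x (x ⊔ base (A.leftPt a ha)) := by
    intro a
    induction a with
    | zero =>
      intro ha _
      rw [sup_eq_left.2 (base_le.2 (leftPt_le.2 (Nat.zero_le _)))]
    | succ a ih =>
      intro ha hy
      exact step ⟨a, ha⟩ (base (A.leftPt a (by omega))) _ (.inl rfl)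
        (fun hc => (collapsesLeft_iff_eye c ⟨a, ha⟩).2 hc) hy
        (ih _ ((base_le_base.2 (leftPt_le.2 (Nat.le_succ _))).trans hy))
  have hright : ∀ b hb, base (A.rightPt b hb) ≤ y → c.r x (x ⊔ base (A.rightPt b hb)) := by
    intro b
    induction b with
    | zero =>
      intro hb _
      rw [sup_eq_left.2 (base_le.2 (rightPt_le.2 (Nat.zero_le _)))]
    | succ b ih =>
      intro hb hy
      exact step ⟨b, hb⟩ (base (A.rightPt b (by omega))) _ (.inr (.inl rfl))
        (fun hc => (collapsesRight_iff_eye c ⟨b, hb⟩).2 hc) hy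
        (ih _ ((base_le_base.2 (rightPt_le.2 (Nat.le_succ _))).trans hy))
  have hbase : ∀ z, base z ≤ y → c.r x (x ⊔ base z) := by
    intro z hz
    have h1 := hleft z.x z.hx ((base_le_base.2 (leftPt_le.2 le_rfl)).trans hz)
    have h2 := hright z.y z.hy ((base_le_base.2 (rightPt_le.2 le_rfl)).trans hz)
    have h3 := c.sup h1 h2
    rwa [sup_idem, ← sup_sup_distrib_left, base_sup_base, leftPt_sup_rightPt] at h3
  have hall : ∀ w, w ≤ y → c.r x (x ⊔ w) := by
    rintro (z | s) hw
    · exact hbase z hw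
    · exact step s _ _ (.inr (.inr rfl)) id hw (hbase _ ((base_lo_le (eye s)).trans hw))
  have := hall y le_rfl
  rwa [sup_eq_right.2 hxy] at this

theorem conOf_collapsedColors [Finite P] : A.conOf (collapsedColors c) = c := by
  apply LatticeCon.toSetoid_injective
  ext x y
  constructor
  · intro h
    have h' := sameLower_inf x h
    rw [inf_idem, inf_comm] at h'
    have h1 := r_of_sameLower_of_le c ((sameLower _).symm h') inf_le_left
    have h2 := r_of_sameLower_of_le c
      ((sameLower _).trans ((sameLower _).symm h') h) inf_le_right
    exact c.trans (c.symm h1) h2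
  · exact sameLower_of_r c

theorem collapsedColors_conOf [Finite P] (U : LowerSet P) :
    collapsedColors (A.conOf U) = U := by
  ext p
  change CollapsesRight (A.conOf U) (A.headStrip p) ↔ p ∈ U
  constructor
  · intro h
    have := mem_of_sameLower_right (U := U) h (A.headStrip p) (by simp [rightPt])
      (by simp [rightPt])
    rwa [col_of_eq_pos (p := p) rfl] at this
  · intro hp
    refine sameLower_base (rightPt_le.2 (Nat.le_succ _)) fun s hs => ?_
    have h1 : (s : ℕ) ≠ A.pos p := fun e => hs (by rwa [col_of_eq_pos e.symm])
    have := A.pos_col_le s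
    simp only [rightPt, headStrip]
    omega

variable (A) in
/-- The congruences of the lattice correspond to the lower sets of colours. -/
noncomputable def conIso [Finite P] : LatticeCon A.Lat ≃o LowerSet P where
  toFun := collapsedColors
  invFun := A.conOf
  left_inv c := conOf_collapsedColors c
  right_inv U := collapsedColors_conOf U
  map_rel_iff' {c d} := by
    constructor
    · intro h
      rw [← conOf_collapsedColors c, ← conOf_collapsedColors d, LatticeCon.le_iff]
      rintro x y hxy q ⟨s, hs, hq⟩
      exact hxy q ⟨s, fun h' => hs (h h'), hq⟩
    · intro h p hp
      exact LatticeCon.le_iff.1 h _ _ hp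

end Strips

/-! ### Existence of the coloured chain -/

namespace Strips

/-- The elements of a finite ordered set can be numbered compatibly with the order. -/
theorem exists_strictMono_lt_card (P : Type*) [PartialOrder P] [Finite P] :
    ∃ e : P → ℕ, Function.Injective e ∧ Monotone e ∧ ∀ p, e p < Nat.card P := by
  classical
  cases nonempty_fintype P
  let _ : Fintype (LinearExtension P) := ‹Fintype P›
  let g : LinearExtension P ≃o Fin (Fintype.card P) := (Fintype.orderIsoFinOfCardEq _ rfl).symm
  refine ⟨fun p => g (toLinearExtension p), fun p q h => ?_, fun p q h => ?_, fun p => ?_⟩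
  · exact g.injective (Fin.ext h)
  · exact g.monotone (toLinearExtension.monotone h)
  · rw [Nat.card_eq_fintype_card]
    exact (g _).2

/-- A finite type with an injective key can be listed by increasing key. -/
theorem exists_equiv_fin_of_key {T : Type*} [Finite T] (key : T → ℕ)
    (hkey : Function.Injective key) :
    ∃ φ : T ≃ Fin (Nat.card T), ∀ t t', φ t ≤ φ t' ↔ key t ≤ key t' := by
  classical
  cases nonempty_fintype T
  let _ : LinearOrder T := LinearOrder.lift' key hkey
  let g : T ≃o Fin (Nat.card T) :=
    (Fintype.orderIsoFinOfCardEq T Nat.card_eq_fintype_card.symm).symm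
  exact ⟨g.toEquiv, fun t t' => g.le_iff_le⟩

/-- Every finite ordered set colours a chain with at most `n ^ 2` edges: list the pairs `p ≤ q`
by increasing `q`, with `p = q` first. -/
theorem exists_strips (P : Type*) [PartialOrder P] [Finite P] :
    ∃ A : Strips P, A.m ≤ Nat.card P ^ 2 := by
  obtain ⟨e, he, hmono, hlt⟩ := exists_strictMono_lt_card P
  let T := {x : P × P // x.1 ≤ x.2}
  -- The offset is less than `n`, so the blocks do not overlap, and it vanishes for `p = q`, so the
  -- distinguished strip heads its block. As `e` is monotone, the subtraction is not truncated, and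
  -- the block of `p` never comes after that of `q` when `p ≤ q`.
  let key : T → ℕ := fun t => e t.1.2 * Nat.card P + (e t.1.2 - e t.1.1)
  have key_lt : ∀ t : T, key t < (e t.1.2 + 1) * Nat.card P := by
    intro t
    have := hlt t.1.2
    simp only [key, add_mul, one_mul]
    omega
  have block_le : ∀ {q : P} {t : T}, e q * Nat.card P ≤ key t → e q ≤ e t.1.2 := by
    intro q t h
    exact Nat.lt_succ_iff.1 (lt_of_mul_lt_mul_right (h.trans_lt (key_lt t)) (Nat.zero_le _))
  have le_key : ∀ t : T, e t.1.2 * Nat.card P ≤ key t := fun t => Nat.le_add_right _ _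
  have hkey : Function.Injective key := by
    rintro t t' h
    have h1 : e t.1.2 = e t'.1.2 :=
      le_antisymm (block_le ((le_key t).trans h.le)) (block_le ((le_key t').trans h.ge))
    have h2 := hmono t.2
    have h3 := hmono t'.2
    simp only [key, h1] at h
    have h4 : e t.1.1 = e t'.1.1 := by omega
    exact Subtype.ext (Prod.ext (he h4) (he h1))
  obtain ⟨φ, hφ⟩ := exists_equiv_fin_of_key key hkey
  let d : P → T := fun p => ⟨(p, p), le_rfl⟩
  have key_d : ∀ p, key (d p) = e p * Nat.card P := fun p => by simp [key, d]
  have le_iff : ∀ (t : T) (s : Fin (Nat.card T)), (φ t : ℕ) ≤ s ↔ key t ≤ key (φ.symm s) := by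
    intro t s
    rw [← hφ, φ.apply_symm_apply]
    rfl
  have mono_d : ∀ {p q : P}, e p ≤ e q → (φ (d p) : ℕ) ≤ φ (d q) := by
    intro p q h
    rw [le_iff, φ.symm_apply_apply, key_d, key_d]
    exact Nat.mul_le_mul_right _ h
  refine ⟨{ m := Nat.card T
            pos := fun p => φ (d p)
            col := fun s => (φ.symm s).1.1
            pos_lt := fun p => (φ (d p)).2
            col_pos := fun p => by simp [d]
            pos_col_le := ?_
            sep := ?_
            col_le := ?_
            exists_strip := ?_ }, ?_⟩
  · intro s
    rw [le_iff, key_d]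
    exact (Nat.mul_le_mul_right _ (hmono (φ.symm s).2)).trans (le_key _)
  · intro s hs
    refine ⟨(φ.symm s).1.2, ?_, ?_⟩
    · refine lt_of_le_of_ne (mono_d (hmono (φ.symm s).2)) fun h => hs.ne ?_
      have h1 := congrArg (fun t : T => t.1.1) (φ.injective (Fin.ext h))
      have h2 : φ.symm s = d (φ.symm s).1.1 := Subtype.ext (Prod.ext rfl h1.symm)
      rw [← h2, φ.apply_symm_apply]
    · rw [le_iff, key_d]
      exact le_key _
  · intro s q h1 h2
    rw [le_iff, key_d] at h1
    have h3 := h2 (φ.symm s).1.2 (by rw [le_iff, key_d]; exact le_key _)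
    rw [le_iff, φ.symm_apply_apply, key_d] at h3
    have h4 : e (φ.symm s).1.2 ≤ e q := block_le (t := d q) h3
    have h5 : q = (φ.symm s).1.2 := he (le_antisymm (block_le h1) h4)
    rw [h5]
    exact (φ.symm s).2
  · intro p q hpq
    refine ⟨φ ⟨(p, q), hpq⟩, by simp, ?_, ?_⟩
    · rw [le_iff, φ.symm_apply_apply, key_d]
      exact le_key ⟨(p, q), hpq⟩
    · intro r hr
      rw [le_iff, φ.symm_apply_apply, key_d] at hr
      exact mono_d (block_le hr)
  · have := Nat.card_le_card_of_injective (Subtype.val : T → P × P) Subtype.val_injective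
    rw [Nat.card_prod] at this
    rwa [sq]

end Strips

/-! ### The theorem and its constant -/

theorem theoremT :
    ∃ C : ℕ, ∀ (D : Type*) [DistribLattice D] [Finite D] [Nonempty D],
      ∃ (S : Type) (_ : Lattice S),
        Finite S ∧ Nonempty S ∧
        IsUpperModularLattice S ∧
        IsPlanarOrder S ∧
        Nonempty (LatticeCon S ≃o D) ∧
        (1 ≤ Nat.card {p : D // SupIrred p} →
          Nat.card S ≤ C * Nat.card {p : D // SupIrred p} ^ 3) := by
  -- With `m ≤ n ^ 2` the size is at most `2 * n ^ 3 + 2 * n ^ 2 + 2 * n + 1`, and for `n ≥ 1` this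
  -- is at most `7 * n ^ 3`.
  refine ⟨7, fun D _ _ _ => ?_⟩
  classical
  cases nonempty_fintype D
  let _ : OrderBot D := (Fintype.toBoundedOrder D).toOrderBot
  obtain ⟨A, hA⟩ := Strips.exists_strips {p : D // SupIrred p}
  refine ⟨A.Lat, inferInstance, inferInstance, ⟨.base (A.diagPt 0 (Nat.zero_le _))⟩,
    isUpperModularLattice_of_isWeakUpperModularLattice, Strips.isPlanarOrder_lat,
    ⟨A.conIso.trans OrderIso.lowerSetSupIrred.symm⟩, fun hn => ?_⟩
  refine (Strips.card_lat_le A).trans ?_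
  generalize Nat.card {p : D // SupIrred p} = n at *
  have h1 : n * A.m ≤ n * n ^ 2 := Nat.mul_le_mul_left _ hA
  have h2 : n ^ 2 ≤ n ^ 3 := Nat.pow_le_pow_right hn (by norm_num)
  have h3 : n ≤ n ^ 3 := Nat.le_self_pow (by norm_num) n
  have h4 : n * n ^ 2 = n ^ 3 := by ring
  nlinarith
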